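/- A compact metric graph $\Gamma$ is a connected finite graph (loops and multiple edges allowed) with $E\ge 1$ edges and $V$ vertices, in which every edge $e$ is identified with an interval $[0,\ell_e]$ of length $\ell_e>0$ and edges are glued at their common vertices. Write $|\Gamma|=\sum_e \ell_e$ for its total length, $\operatorname{dist}$ for the shortest-path distance, and $\beta=E-V+1$ for its first Betti number. Let $$\rho(\Gamma)=\frac{1}{|\Gamma|^2}\int_\Gamma\int_\Gamma \operatorname{dist}(x,y)\,dy\,dx,\qquad \mu_2(\Gamma)=\inf\left\{\frac{\|u'\|_{L^2(\Gamma)}^2}{\|u\|_{L^2(\Gamma)}^2}\;:\;0\neq u\in H^1(\Gamma),\ \int_\Gamma u\,dx=0\right\}$$ be its mean distance and its spectral gap, where $H^1(\Gamma)$ is the space of continuous functions $u$ on $\Gamma$ whose edgewise weak derivative $u'$ lies in $L^2(\Gamma)$. Then $$\frac{\pi^2(2E-1)^2}{16E^4}\;\le\;\mu_2(\Gamma)\,\rho(\Gamma)^2\;\le\;\pi^2(1+\beta)^2 ,$$ and, unless $\Gamma$ is a loop with a single edge and a single vertex, $$\mu_2(\Gamma)\,\rho(\Gamma)^2\;\le\;\min\left\{\frac{\pi^2E^2}{9},\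 \pi^2(1+\beta)^2\right\}.$$ -/

import Mathlib

open MeasureTheory
open scoped ContDiff

/-- A metric graph with vertex set `V` and edge set `E`; loops and multiple edges are allowed.
Each edge `e` is parametrised by the interval `[0, len e]`, with `0` placed at the vertex `src e`
and `len e` placed at the vertex `tgt e`. -/
structure MetricGraph (V E : Type*) where
  src : E → V
  tgt : E → V
  len : E → ℝ
  len_pos : ∀ e, 0 < len e

namespace MetricGraph

/-- Connectedness: there is a vertex, and any two vertices are joined by a chain of edges,
each traversed in either direction. -/
def Connected {V E : Type*} (G : MetricGraph V E) : Prop :=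
  Nonempty V ∧
    ∀ v w : V, Relation.EqvGen (fun a b : V => ∃ e, G.src e = a ∧ G.tgt e = b) v w

/-- The points of the metric graph: the vertices and the interior points of the edges. -/
inductive Space {V E : Type*} (G : MetricGraph V E)
  | vertex (v : V) : Space G
  | interior (e : E) (x : ℝ) (hx : x ∈ Set.Ioo 0 (G.len e)) : Space G

/-- The point with coordinate `x ∈ [0, len e]` on the closed edge `e`. Coordinates `0` and `len e`
give the vertices `src e` and `tgt e`, so that edges are glued at their common vertices. -/
noncomputable def pt {V E : Type*} (G : MetricGraph V E) (e : E) (x : ℝ) : G.Space :=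
  if h0 : x ≤ 0 then Space.vertex (G.src e)
  else if h1 : G.len e ≤ x then Space.vertex (G.tgt e)
  else Space.interior e x ⟨lt_of_not_ge h0, lt_of_not_ge h1⟩

/-- `G.HasPath p q r`: there is a path from `p` to `q` of length `r`, made of finitely many
segments, each inside one closed edge and measured by the Euclidean distance on this edge. -/
inductive HasPath {V E : Type*} (G : MetricGraph V E) : G.Space → G.Space → ℝ → Prop
  | refl (p : G.Space) : HasPath G p p 0
  | step (p : G.Space) (e : E) (s t r : ℝ)
      (hs : s ∈ Set.Icc 0 (G.len e)) (ht : t ∈ Set.Icc 0 (G.len e))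
      (h : HasPath G p (G.pt e s) r) : HasPath G p (G.pt e t) (r + |t - s|)

/-- The shortest-path distance. -/
noncomputable def dist {V E : Type*} (G : MetricGraph V E) (p q : G.Space) : ℝ :=
  sInf {r : ℝ | G.HasPath p q r}

/-- The total length. -/
noncomputable def totalLength {V E : Type*} [Fintype E] (G : MetricGraph V E) : ℝ :=
  ∑ e, G.len e

/-- The first Betti number `|E| - |V| + 1` of a connected graph. -/
def betti {V E : Type*} [Fintype V] [Fintype E] (_G : MetricGraph V E) : ℤ :=
  (Fintype.card E : ℤ) - (Fintype.card V : ℤ) + 1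

/-- The integral over the graph with respect to Lebesgue measure on each edge. -/
noncomputable def integral {V E : Type*} [Fintype E] (G : MetricGraph V E)
    (f : G.Space → ℝ) : ℝ :=
  ∑ e, ∫ x in (0 : ℝ)..(G.len e), f (G.pt e x)

/-- The mean distance function. -/
noncomputable def meanDistFrom {V E : Type*} [Fintype E] (G : MetricGraph V E)
    (p : G.Space) : ℝ :=
  (1 / G.totalLength) * G.integral (fun q => G.dist p q)

/-- The mean distance of the graph. -/
noncomputable def meanDist {V E : Type*} [Fintype E] (G : MetricGraph V E) : ℝ :=
  (1 / G.totalLength) * G.integral G.meanDistFrom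

/-- `u` is in `H¹` of the graph, with weak derivative `g e` on the edge `e`: `u` is continuous on
the graph (that is, along each closed edge; the value at a vertex is shared by all edges that meet
there), and on each edge its distributional derivative is the square integrable function `g e`. -/
structure IsH1 {V E : Type*} (G : MetricGraph V E) (u : G.Space → ℝ) (g : E → ℝ → ℝ) : Prop where
  continuousOn : ∀ e, ContinuousOn (fun x : ℝ => u (G.pt e x)) (Set.Icc 0 (G.len e))
  memLp : ∀ e, MemLp (g e) 2 (volume.restrict (Set.Ioo 0 (G.len e)))
  weakDeriv : ∀ e, ∀ φ : ℝ → ℝ, ContDiff ℝ ∞ φ → HasCompactSupport φ →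
    tsupport φ ⊆ Set.Ioo 0 (G.len e) →
    ∫ x in (0 : ℝ)..(G.len e), u (G.pt e x) * deriv φ x
      = -∫ x in (0 : ℝ)..(G.len e), g e x * φ x

/-- The spectral gap `μ₂`: the infimum of the Rayleigh quotients of the nonzero functions in `H¹`
with mean value zero. -/
noncomputable def spectralGap {V E : Type*} [Fintype E] (G : MetricGraph V E) : ℝ :=
  sInf {q : ℝ | ∃ (u : G.Space → ℝ) (g : E → ℝ → ℝ), G.IsH1 u g ∧
    G.integral u = 0 ∧ G.integral (fun p => u p ^ 2) ≠ 0 ∧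
    q = (∑ e, ∫ x in (0 : ℝ)..(G.len e), g e x ^ 2) / G.integral (fun p => u p ^ 2)}

/-- A connected graph is a loop when it has exactly one edge and exactly one vertex. -/
def IsLoop {V E : Type*} [Fintype V] [Fintype E] (_G : MetricGraph V E) : Prop :=
  Fintype.card E = 1 ∧ Fintype.card V = 1

end MetricGraph

/-!
The theorem combines two-sided estimates of the mean distance `ρ` with two-sided estimates of the
spectral gap `μ₂`. Write `L` for the total length and `E` for the number of edges.

*Mean distance.* The bound `ρ ≤ L / 3` (`meanDist_le_third`) is proved by growing the graph edge by
edge: if a connected part `S` satisfies `d(v, w) ≤ |S|`, `∫_S d(v, ·) ≤ |S|² / 2` and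
`∫∫_{S×S} d ≤ |S|³ / 3`, then attaching an edge of length `ℓ` at a vertex of `S` reproduces these
bounds with `|S| + ℓ` in place of `|S|`. The bound `L (2E - 1) / (4 E²) ≤ ρ` (`le_meanDist`)
compares the graph with the bouquet of circles obtained by identifying all vertices, whose mean
distance is explicit, and then optimises over the edge lengths.

*Spectral gap from above.* With two edges of total length at least `2 L / E`, a cosine on the circle
they form, extended by a constant, gives `μ₂ ≤ (π E / L)²` (`spectralGap_le_card_edges`); a graph
with one edge that is not a loop is an interval. For the bound with the first Betti number `β`, the
graph is cut open at `β` places to a tree. For any two points at distance `d` the tree has a path of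
length `r ≥ d` and a function `h` which is the arc length along this path and constant on the
branches attached to it. The functions `F = ∑ cₖ cos (k π h / r)`, `0 ≤ k ≤ β + 1`, satisfy
`‖F'‖² ≤ ((β + 1) π / r)² ‖F‖²`, and their `β + 2` coefficients can be chosen, not all zero, to
satisfy the `β` gluing conditions and to give mean value zero. Hence `√μ₂ d ≤ π (1 + β)` for all
pairs of points, so the same bound holds for `ρ` (`spectralGap_mul_meanDist_sq_le_betti`).

*Spectral gap from below.* A connected graph has a closed walk using every edge once in each
direction. Along it a function in `H¹` with mean value zero becomes a periodic function of period
`2 L` with mean value zero, and Wirtinger's inequality gives `μ₂ ≥ (π / L)²` (`le_spectralGap`).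
-/

namespace MetricGraph

variable {V E W : Type*} {G : MetricGraph V E}

/-! ### Points of the graph and functions given edge by edge -/

theorem pt_zero (G : MetricGraph V E) (e : E) : G.pt e 0 = Space.vertex (G.src e) := by
  simp [pt]

theorem pt_len (G : MetricGraph V E) (e : E) : G.pt e (G.len e) = Space.vertex (G.tgt e) := by
  simp [pt, not_le.2 (G.len_pos e)]

theorem pt_of_mem_Ioo {e : E} {x : ℝ} (hx : x ∈ Set.Ioo 0 (G.len e)) :
    G.pt e x = Space.interior e x hx := by
  simp [pt, not_le.2 hx.1, not_le.2 hx.2]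

theorem len_nonneg (G : MetricGraph V E) (e : E) : 0 ≤ G.len e := (G.len_pos e).le

theorem zero_mem (G : MetricGraph V E) (e : E) : (0 : ℝ) ∈ Set.Icc 0 (G.len e) :=
  ⟨le_rfl, G.len_nonneg e⟩

theorem len_mem (G : MetricGraph V E) (e : E) : G.len e ∈ Set.Icc 0 (G.len e) :=
  ⟨G.len_nonneg e, le_rfl⟩

/-- The function on the graph with value `a v` at the vertex `v` and given by `f e` in the interior
of the edge `e`. -/
def glue (G : MetricGraph V E) (a : V → ℝ) (f : E → ℝ → ℝ) : G.Space → ℝ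
  | .vertex v => a v
  | .interior e x _ => f e x

theorem glue_pt {a : V → ℝ} {f : E → ℝ → ℝ} {e : E} (h0 : f e 0 = a (G.src e))
    (h1 : f e (G.len e) = a (G.tgt e)) {x : ℝ} (hx : x ∈ Set.Icc 0 (G.len e)) :
    G.glue a f (G.pt e x) = f e x := by
  rcases eq_or_lt_of_le hx.1 with rfl | h
  · rw [pt_zero, h0]; rfl
  rcases eq_or_lt_of_le hx.2 with rfl | h'
  · rw [pt_len, h1]; rfl
  · rw [pt_of_mem_Ioo ⟨h, h'⟩]; rfl

/-! ### Paths and the distance -/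

namespace HasPath

theorem nonneg {p q : G.Space} {r : ℝ} (h : G.HasPath p q r) : 0 ≤ r := by
  induction h with
  | refl => exact le_rfl
  | step e s t r hs ht h ih => positivity

theorem trans {p q w : G.Space} {r r' : ℝ} (h : G.HasPath p q r) (h' : G.HasPath q w r') :
    G.HasPath p w (r + r') := by
  induction h' with
  | refl => simpa using h
  | step e s t r hs ht h ih =>
    rw [← add_assoc]
    exact .step _ e s t _ hs ht ih

theorem edge {e : E} {s t : ℝ} (hs : s ∈ Set.Icc 0 (G.len e)) (ht : t ∈ Set.Icc 0 (G.len e)) :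
    G.HasPath (G.pt e s) (G.pt e t) |t - s| := by
  simpa using HasPath.step _ e s t 0 hs ht (.refl _)

theorem symm {p q : G.Space} {r : ℝ} (h : G.HasPath p q r) : G.HasPath q p r := by
  induction h with
  | refl => exact .refl p
  | step e s t r hs ht h ih =>
    rw [add_comm, abs_sub_comm]
    exact (edge ht hs).trans ih

/-- A function that is 1-Lipschitz along every closed edge varies along a path by at most its
length. -/
theorem sub_le {Φ : G.Space → ℝ}
    (hΦ : ∀ e, ∀ s ∈ Set.Icc 0 (G.len e), ∀ t ∈ Set.Icc 0 (G.len e),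
      Φ (G.pt e t) - Φ (G.pt e s) ≤ |t - s|) {p q : G.Space} {r : ℝ} (h : G.HasPath p q r) :
    Φ q - Φ p ≤ r := by
  induction h with
  | refl => simp
  | step e s t r hs ht h ih => linarith [hΦ e s hs t ht]

end HasPath

theorem dist_le_of_hasPath {p q : G.Space} {r : ℝ} (h : G.HasPath p q r) : G.dist p q ≤ r :=
  csInf_le ⟨0, fun _ h => HasPath.nonneg h⟩ h

theorem dist_nonneg (p q : G.Space) : 0 ≤ G.dist p q :=
  Real.sInf_nonneg fun _ h => HasPath.nonneg h

theorem dist_comm (p q : G.Space) : G.dist p q = G.dist q p := by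
  unfold dist
  congr 1
  ext r
  exact ⟨HasPath.symm, HasPath.symm⟩

namespace Connected

theorem exists_hasPath_vertex (hG : G.Connected) (v w : V) :
    ∃ r, G.HasPath (.vertex v) (.vertex w) r := by
  induction hG.2 v w with
  | rel a b h =>
    obtain ⟨e, rfl, rfl⟩ := h
    have := HasPath.edge (G.zero_mem e) (G.len_mem e)
    rw [pt_zero, pt_len] at this
    exact ⟨_, this⟩
  | refl a => exact ⟨0, .refl _⟩
  | symm a b _ ih => exact ih.imp fun _ h => h.symm
  | trans a b c _ _ ih ih' =>
    obtain ⟨r, h⟩ := ih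
    obtain ⟨r', h'⟩ := ih'
    exact ⟨_, h.trans h'⟩

theorem exists_hasPath (hG : G.Connected) (p q : G.Space) : ∃ r, G.HasPath p q r := by
  have key : ∀ p : G.Space, ∃ v r, G.HasPath p (.vertex v) r := by
    rintro (v | ⟨e, x, hx⟩)
    · exact ⟨v, 0, .refl _⟩
    · have := HasPath.edge (Set.Ioo_subset_Icc_self hx) (G.zero_mem e)
      rw [pt_zero, pt_of_mem_Ioo hx] at this
      exact ⟨_, _, this⟩
  obtain ⟨v, r, hv⟩ := key p
  obtain ⟨w, r', hw⟩ := key q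
  obtain ⟨r'', h⟩ := hG.exists_hasPath_vertex v w
  exact ⟨_, (hv.trans h).trans hw.symm⟩

theorem le_dist (hG : G.Connected) {p q : G.Space} {c : ℝ}
    (h : ∀ r, G.HasPath p q r → c ≤ r) : c ≤ G.dist p q :=
  le_csInf (hG.exists_hasPath p q) h

theorem dist_triangle (hG : G.Connected) (p q w : G.Space) :
    G.dist p w ≤ G.dist p q + G.dist q w := by
  have : G.dist p w - G.dist q w ≤ G.dist p q := by
    refine hG.le_dist fun r hr => ?_
    have : G.dist p w - r ≤ G.dist q w :=
      hG.le_dist fun r' hr' => by linarith [dist_le_of_hasPath (hr.trans hr')]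
    linarith
  linarith

end Connected

theorem dist_pt_le {e : E} {s t : ℝ} (hs : s ∈ Set.Icc 0 (G.len e))
    (ht : t ∈ Set.Icc 0 (G.len e)) : G.dist (G.pt e s) (G.pt e t) ≤ |t - s| :=
  dist_le_of_hasPath (.edge hs ht)

theorem Connected.abs_dist_sub_le (hG : G.Connected) (p : G.Space) {e : E} {s t : ℝ}
    (hs : s ∈ Set.Icc 0 (G.len e)) (ht : t ∈ Set.Icc 0 (G.len e)) :
    |G.dist p (G.pt e t) - G.dist p (G.pt e s)| ≤ |t - s| := by
  have h1 := hG.dist_triangle p (G.pt e s) (G.pt e t)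
  have h2 := hG.dist_triangle p (G.pt e t) (G.pt e s)
  have h3 := dist_pt_le hs ht
  rw [dist_comm (G.pt e t)] at h2
  rw [abs_le]
  constructor <;> linarith

theorem _root_.ContinuousOn.of_abs_sub_le {f : ℝ → ℝ} {S : Set ℝ} {C : ℝ} (hC : 0 ≤ C)
    (h : ∀ s ∈ S, ∀ t ∈ S, |f t - f s| ≤ C * |t - s|) : ContinuousOn f S :=
  (LipschitzOnWith.of_dist_le_mul (K := ⟨C, hC⟩) fun x hx y hy => h y hy x hx).continuousOn

theorem Connected.continuousOn_dist (hG : G.Connected) (p : G.Space) (e : E) :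
    ContinuousOn (fun t => G.dist p (G.pt e t)) (Set.Icc 0 (G.len e)) :=
  .of_abs_sub_le zero_le_one fun s hs t ht => by simpa using hG.abs_dist_sub_le p hs ht

theorem intervalIntegrable_of_continuousOn {f : ℝ → ℝ} {e : E}
    (h : ContinuousOn f (Set.Icc 0 (G.len e))) : IntervalIntegrable f volume 0 (G.len e) :=
  ContinuousOn.intervalIntegrable (by rwa [Set.uIcc_of_le (G.len_nonneg e)])

theorem integral_mono_edge {f g : ℝ → ℝ} {e : E}
    (hf : ContinuousOn f (Set.Icc 0 (G.len e))) (hg : ContinuousOn g (Set.Icc 0 (G.len e)))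
    (h : ∀ t ∈ Set.Icc 0 (G.len e), f t ≤ g t) :
    ∫ t in (0 : ℝ)..(G.len e), f t ≤ ∫ t in (0 : ℝ)..(G.len e), g t :=
  intervalIntegral.integral_mono_on (G.len_nonneg e) (intervalIntegrable_of_continuousOn hf)
    (intervalIntegrable_of_continuousOn hg) h

/-- The integral over the edge `e` of the distance to `p`. -/
noncomputable def distInt (G : MetricGraph V E) (p : G.Space) (e : E) : ℝ :=
  ∫ t in (0 : ℝ)..(G.len e), G.dist p (G.pt e t)

theorem Connected.abs_distInt_sub_le (hG : G.Connected) (f : E) {e : E} {s t : ℝ}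
    (hs : s ∈ Set.Icc 0 (G.len e)) (ht : t ∈ Set.Icc 0 (G.len e)) :
    |G.distInt (G.pt e t) f - G.distInt (G.pt e s) f| ≤ G.len f * |t - s| := by
  unfold distInt
  rw [← intervalIntegral.integral_sub
    (intervalIntegrable_of_continuousOn (hG.continuousOn_dist _ f))
    (intervalIntegrable_of_continuousOn (hG.continuousOn_dist _ f))]
  have := intervalIntegral.norm_integral_le_of_norm_le_const (a := 0) (b := G.len f)
    (C := |t - s|)
    (f := fun x => G.dist (G.pt e t) (G.pt f x) - G.dist (G.pt e s) (G.pt f x))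
    (fun x _ => by
      rw [dist_comm _ (G.pt f x), dist_comm _ (G.pt f x)]
      exact hG.abs_dist_sub_le (G.pt f x) hs ht)
  rw [sub_zero, abs_of_pos (G.len_pos f), mul_comm] at this
  exact this

theorem Connected.continuousOn_distInt (hG : G.Connected) (f e : E) :
    ContinuousOn (fun s => G.distInt (G.pt e s) f) (Set.Icc 0 (G.len e)) :=
  .of_abs_sub_le (G.len_nonneg f) fun _ hs _ ht => hG.abs_distInt_sub_le f hs ht

/-- The integral of the distance over the product of two edges. -/
noncomputable def distIntInt (G : MetricGraph V E) (e f : E) : ℝ :=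
  ∫ s in (0 : ℝ)..(G.len e), G.distInt (G.pt e s) f

theorem totalLength_pos [Fintype E] [Nonempty E] (G : MetricGraph V E) : 0 < G.totalLength :=
  Finset.sum_pos (fun e _ => G.len_pos e) Finset.univ_nonempty

theorem Connected.meanDist_eq [Fintype E] (hG : G.Connected) :
    G.meanDist = (1 / G.totalLength) * ((1 / G.totalLength) * ∑ e, ∑ f, G.distIntInt e f) := by
  unfold meanDist
  congr 1
  rw [integral, Finset.mul_sum]
  refine Finset.sum_congr rfl fun e _ => ?_
  simp only [meanDistFrom, integral]
  rw [intervalIntegral.integral_const_mul]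
  congr 1
  exact intervalIntegral.integral_finsetSum fun f _ =>
    intervalIntegrable_of_continuousOn (hG.continuousOn_distInt f e)

theorem Connected.distIntInt_le (hG : G.Connected) {M : ℝ} {e f : E}
    (hM : ∀ s ∈ Set.Icc 0 (G.len e), ∀ t ∈ Set.Icc 0 (G.len f),
      G.dist (G.pt e s) (G.pt f t) ≤ M) : G.distIntInt e f ≤ M * G.len e * G.len f := by
  have h1 : ∀ s ∈ Set.Icc 0 (G.len e), G.distInt (G.pt e s) f ≤ M * G.len f := fun s hs => by
    refine (integral_mono_edge (hG.continuousOn_dist _ f) continuousOn_const (hM s hs)).trans ?_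
    simp [mul_comm]
  refine (integral_mono_edge (hG.continuousOn_distInt f e) continuousOn_const h1).trans ?_
  simp only [intervalIntegral.integral_const, sub_zero, smul_eq_mul]
  exact le_of_eq (by ring)

theorem Connected.meanDist_le_of_forall_dist_le [Fintype E] [Nonempty E] (hG : G.Connected)
    {M : ℝ} (hM : ∀ e, ∀ s ∈ Set.Icc 0 (G.len e), ∀ f, ∀ t ∈ Set.Icc 0 (G.len f),
      G.dist (G.pt e s) (G.pt f t) ≤ M) : G.meanDist ≤ M := by
  have hL := G.totalLength_pos
  rw [hG.meanDist_eq, ← mul_assoc, div_mul_div_comm, one_mul, div_mul_eq_mul_div, one_mul,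
    div_le_iff₀ (by positivity)]
  calc _ ≤ ∑ e, ∑ f, M * G.len e * G.len f :=
        Finset.sum_le_sum fun e _ => Finset.sum_le_sum fun f _ =>
          hG.distIntInt_le fun s hs t ht => hM e s hs f t ht
    _ = _ := by
        simp_rw [← Finset.mul_sum, ← Finset.sum_mul, ← Finset.mul_sum]
        rw [totalLength]
        ring

/-! ### Growing a connected graph edge by edge -/

/-- Induction for connected graphs: the graph arises from any of its vertices by successively
adding edges that touch the part already present. In the step, `v` is an end of the new edge `e`
which is already present, and `w` is its other end. -/
theorem Connected.edge_induction [Fintype V] [Fintype E] [DecidableEq V] [DecidableEq E]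
    (hG : G.Connected) (P : Finset E → Finset V → Prop) (v₀ : V) (base : P ∅ {v₀})
    (step : ∀ (S : Finset E) (A : Finset V) (e : E) (v w : V), e ∉ S → v ∈ A →
      (G.src e = v ∧ G.tgt e = w ∨ G.tgt e = v ∧ G.src e = w) → P S A →
      P (insert e S) (insert w A)) :
    P Finset.univ Finset.univ := by
  -- a set of vertices which no edge leaves is everything
  have full : ∀ A : Finset V, v₀ ∈ A → (∀ e, G.src e ∈ A ↔ G.tgt e ∈ A) → A = Finset.univ := by
    intro A h0 hA
    have : ∀ v w, Relation.EqvGen (fun a b : V => ∃ e, G.src e = a ∧ G.tgt e = b) v w →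
        (v ∈ A ↔ w ∈ A) := by
      intro v w h
      induction h with
      | rel a b h => obtain ⟨e, rfl, rfl⟩ := h; exact hA e
      | refl a => rfl
      | symm a b _ ih => exact ih.symm
      | trans a b c _ _ ih ih' => exact ih.trans ih'
    exact Finset.eq_univ_of_forall fun w => (this _ _ (hG.2 v₀ w)).1 h0
  have key : ∀ n ≤ Fintype.card E, ∃ S A, S.card = n ∧ v₀ ∈ A ∧
      (∀ f ∈ S, G.src f ∈ A ∧ G.tgt f ∈ A) ∧ P S A := by
    intro n
    induction n with
    | zero => exact fun _ => ⟨∅, {v₀}, rfl, by simp, by simp, base⟩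
    | succ n ih =>
      intro hn
      obtain ⟨S, A, hS, h0, hA, hP⟩ := ih (by omega)
      have : ∃ e ∉ S, G.src e ∈ A ∨ G.tgt e ∈ A := by
        by_contra! hcon
        have hAu := full A h0 fun e => by
          by_cases he : e ∈ S
          · simp [hA e he]
          · simp [hcon e he]
        have hSu : S = Finset.univ :=
          Finset.eq_univ_of_forall fun e => by
            by_contra he
            exact (hcon e he).1 (by simp [hAu])
        rw [hSu, Finset.card_univ] at hS
        omega
      obtain ⟨e, he, hv⟩ := this
      obtain ⟨v, w, hv, hvw⟩ : ∃ v w, v ∈ A ∧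
          (G.src e = v ∧ G.tgt e = w ∨ G.tgt e = v ∧ G.src e = w) := by
        rcases hv with hv | hv
        · exact ⟨_, _, hv, .inl ⟨rfl, rfl⟩⟩
        · exact ⟨_, _, hv, .inr ⟨rfl, rfl⟩⟩
      refine ⟨insert e S, insert w A, by simp [he, hS], by simp [h0], fun f hf => ?_,
        step S A e v w he hv hvw hP⟩
      rcases Finset.mem_insert.1 hf with rfl | hf
      · rcases hvw with ⟨rfl, rfl⟩ | ⟨rfl, rfl⟩ <;> simp [hv]
      · simp [hA f hf]
  obtain ⟨S, A, hS, h0, hA, hP⟩ := key _ le_rfl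
  obtain rfl : S = Finset.univ := (Finset.card_eq_iff_eq_univ S).1 hS
  rwa [full A h0 fun e => by simp [hA e (Finset.mem_univ e)]] at hP

/-! ### The mean distance is at most a third of the length -/

/-- The coordinate `c` of the end `v` of an edge with ends `v` and `w`. -/
theorem exists_coord {e : E} {v w : V}
    (h : G.src e = v ∧ G.tgt e = w ∨ G.tgt e = v ∧ G.src e = w) :
    ∃ c, (c = 0 ∨ c = G.len e) ∧ G.pt e c = .vertex v ∧ G.pt e (G.len e - c) = .vertex w := by
  rcases h with ⟨rfl, rfl⟩ | ⟨rfl, rfl⟩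
  · exact ⟨0, .inl rfl, pt_zero G e, by rw [sub_zero, pt_len]⟩
  · exact ⟨G.len e, .inr rfl, pt_len G e, by rw [sub_self, pt_zero]⟩

theorem coord_mem {e : E} {c : ℝ} (hc : c = 0 ∨ c = G.len e) : c ∈ Set.Icc 0 (G.len e) := by
  rcases hc with rfl | rfl
  · exact G.zero_mem e
  · exact G.len_mem e

theorem integral_abs_sub_end {l c : ℝ} (hl : 0 ≤ l) (hc : c = 0 ∨ c = l) :
    ∫ t in (0 : ℝ)..l, |t - c| = l ^ 2 / 2 := by
  rcases hc with rfl | rfl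
  · rw [intervalIntegral.integral_congr (g := fun t => t) fun t ht => ?_]
    · simp
    · rw [Set.uIcc_of_le hl] at ht
      simp [abs_of_nonneg ht.1]
  · rw [intervalIntegral.integral_congr (g := fun t => c - t) fun t ht => ?_]
    · rw [intervalIntegral.integral_sub (by simp) (by simp)]
      simp only [intervalIntegral.integral_const, integral_id, smul_eq_mul]
      ring
    · rw [Set.uIcc_of_le hl] at ht
      simp only [abs_sub_comm t c]
      exact abs_of_nonneg (sub_nonneg.2 ht.2)

theorem integral_abs_sub {l s : ℝ} (hs : s ∈ Set.Icc 0 l) :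
    ∫ t in (0 : ℝ)..l, |t - s| = s ^ 2 / 2 + (l - s) ^ 2 / 2 := by
  have hc : Continuous fun t : ℝ => |t - s| := by fun_prop
  rw [← intervalIntegral.integral_add_adjacent_intervals (hc.intervalIntegrable 0 s)
    (hc.intervalIntegrable s l), integral_abs_sub_end hs.1 (.inr rfl)]
  have := intervalIntegral.integral_comp_sub_right (a := s) (b := l) (fun t : ℝ => |t - 0|) s
  simp only [sub_self, sub_zero] at this
  rw [this]
  have h2 := integral_abs_sub_end (sub_nonneg.2 hs.2) (c := 0) (.inl rfl)
  simp only [sub_zero] at h2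
  rw [h2]

theorem distInt_le_of_end (hG : G.Connected) {e : E} {c : ℝ} (hc : c = 0 ∨ c = G.len e)
    (p : G.Space) :
    G.distInt p e ≤ G.dist p (G.pt e c) * G.len e + G.len e ^ 2 / 2 := by
  have hc' := coord_mem hc
  refine (integral_mono_edge (g := fun t => G.dist p (G.pt e c) + |t - c|)
    (hG.continuousOn_dist p e) (by fun_prop) fun t ht =>
      (hG.dist_triangle p (G.pt e c) _).trans (by gcongr; exact dist_pt_le hc' ht)).trans ?_
  have hcont : Continuous fun t : ℝ => |t - c| := by fun_prop
  rw [intervalIntegral.integral_add (by simp) (hcont.intervalIntegrable _ _),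
    integral_abs_sub_end (G.len_nonneg e) hc]
  simp [mul_comm]

theorem distInt_triangle (hG : G.Connected) (p q : G.Space) (f : E) :
    G.distInt p f ≤ G.dist p q * G.len f + G.distInt q f := by
  refine (integral_mono_edge (g := fun t => G.dist p q + G.dist q (G.pt f t))
    (hG.continuousOn_dist p f) (continuousOn_const.add (hG.continuousOn_dist q f))
    fun t _ => hG.dist_triangle p q _).trans ?_
  rw [intervalIntegral.integral_add (by simp)
    (intervalIntegrable_of_continuousOn (hG.continuousOn_dist q f))]
  simp [mul_comm, distInt]

theorem distIntInt_self_le (hG : G.Connected) (e : E) :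
    G.distIntInt e e ≤ G.len e ^ 3 / 3 := by
  have h : ∀ s ∈ Set.Icc 0 (G.len e), G.distInt (G.pt e s) e ≤ s ^ 2 / 2 + (G.len e - s) ^ 2 / 2 :=
    fun s hs => by
      rw [← integral_abs_sub hs]
      exact integral_mono_edge (hG.continuousOn_dist _ e) (by fun_prop) fun t ht =>
        dist_pt_le hs ht
  refine (integral_mono_edge (hG.continuousOn_distInt e e) (by fun_prop) h).trans (le_of_eq ?_)
  rw [intervalIntegral.integral_add (Continuous.intervalIntegrable (by fun_prop) _ _)
    (Continuous.intervalIntegrable (by fun_prop) _ _), intervalIntegral.integral_div,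
    intervalIntegral.integral_div,
    intervalIntegral.integral_comp_sub_left (fun x : ℝ => x ^ 2) (G.len e)]
  simp only [integral_pow, sub_self, sub_zero]
  norm_num

/-- Points of the edge `e` are reached through its end with coordinate `c`, which bounds the double
integral over `e` and `f` by the distances from this end. -/
theorem distIntInt_le_left (hG : G.Connected) {e : E} {c : ℝ} (hc : c = 0 ∨ c = G.len e) (f : E) :
    G.distIntInt e f ≤ G.len e ^ 2 / 2 * G.len f + G.len e * G.distInt (G.pt e c) f := by
  have hc' := coord_mem hc
  refine (integral_mono_edge (g := fun s => |s - c| * G.len f + G.distInt (G.pt e c) f)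
    (hG.continuousOn_distInt f e) (by fun_prop) fun s hs =>
      (distInt_triangle hG _ (G.pt e c) f).trans ?_).trans (le_of_eq ?_)
  · have := G.len_nonneg f
    gcongr
    rw [dist_comm]
    exact dist_pt_le hc' hs
  · rw [intervalIntegral.integral_add (Continuous.intervalIntegrable (by fun_prop) _ _) (by simp),
      intervalIntegral.integral_mul_const, integral_abs_sub_end (G.len_nonneg e) hc]
    simp

theorem distIntInt_le_right (hG : G.Connected) {e : E} {c : ℝ} (hc : c = 0 ∨ c = G.len e) (f : E) :
    G.distIntInt f e ≤ G.len e ^ 2 / 2 * G.len f + G.len e * G.distInt (G.pt e c) f := by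
  refine (integral_mono_edge
    (g := fun s => G.dist (G.pt e c) (G.pt f s) * G.len e + G.len e ^ 2 / 2)
    (hG.continuousOn_distInt e f)
    (((hG.continuousOn_dist _ f).mul continuousOn_const).add continuousOn_const) fun s hs => ?_
    ).trans (le_of_eq ?_)
  · rw [dist_comm (G.pt e c)]
    exact distInt_le_of_end hG hc _
  · have h := (intervalIntegrable_of_continuousOn (hG.continuousOn_dist (G.pt e c) f)).mul_const
      (G.len e)
    rw [intervalIntegral.integral_add h (by simp), intervalIntegral.integral_mul_const]
    simp only [distInt, intervalIntegral.integral_const, smul_eq_mul, sub_zero]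
    ring

/-- The sum of the double integrals of the distance is at most `|G|³ / 3`. When an edge of length
`ℓ` is added to a connected part `S`, the three bounds below pass from `S` to the larger part by the
expansions of `(|S| + ℓ)²` and `(|S| + ℓ)³`. -/
theorem sum_distIntInt_le [Fintype V] [Fintype E] (hG : G.Connected) :
    ∑ e, ∑ f, G.distIntInt e f ≤ G.totalLength ^ 3 / 3 := by
  classical
  let ℓ : Finset E → ℝ := fun S => ∑ e ∈ S, G.len e
  have hℓ : ∀ S, 0 ≤ ℓ S := fun S => Finset.sum_nonneg fun e _ => G.len_nonneg e
  let P : Finset E → Finset V → Prop := fun S A =>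
    (∀ v ∈ A, ∀ w ∈ A, G.dist (.vertex v) (.vertex w) ≤ ℓ S) ∧
    (∀ v ∈ A, ∑ f ∈ S, G.distInt (.vertex v) f ≤ ℓ S ^ 2 / 2) ∧
    ∑ e ∈ S, ∑ f ∈ S, G.distIntInt e f ≤ ℓ S ^ 3 / 3
  obtain ⟨v₀⟩ := hG.1
  refine (hG.edge_induction P v₀ ⟨?_, ?_, ?_⟩ ?_).2.2
  · simpa [ℓ] using dist_le_of_hasPath (HasPath.refl _)
  · simp [ℓ]
  · simp [ℓ]
  rintro S A e v w he hv hvw ⟨h1, h2, h3⟩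
  obtain ⟨c, hc, hcv, hcw⟩ := exists_coord hvw
  have hl := G.len_nonneg e
  have hins : ℓ (insert e S) = G.len e + ℓ S := Finset.sum_insert he
  have hvw' : G.dist (.vertex w) (.vertex v) ≤ G.len e := by
    have hmem : c ∈ Set.Icc 0 (G.len e) ∧ G.len e - c ∈ Set.Icc 0 (G.len e) := by
      rcases hc with rfl | rfl <;> simp [hl]
    rw [← hcv, ← hcw]
    refine (dist_pt_le hmem.2 hmem.1).trans ?_
    rcases hc with rfl | rfl <;> simp [abs_of_nonneg hl]
  have hw1 : ∀ a ∈ A, G.dist (.vertex w) (.vertex a) ≤ G.len e + ℓ S := fun a ha =>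
    (hG.dist_triangle _ (.vertex v) _).trans (add_le_add hvw' (h1 v hv a ha))
  have hv2 := h2 v hv
  refine ⟨?_, ?_, ?_⟩
  · rw [hins]
    intro a ha b hb
    rcases Finset.mem_insert.1 ha with rfl | ha' <;> rcases Finset.mem_insert.1 hb with rfl | hb'
    · exact (dist_le_of_hasPath (HasPath.refl _)).trans (add_nonneg hl (hℓ S))
    · exact hw1 b hb'
    · rw [dist_comm]; exact hw1 a ha'
    · exact (h1 a ha' b hb').trans (le_add_of_nonneg_left hl)
  · rw [hins]
    intro a ha
    rw [Finset.sum_insert he]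
    rcases Finset.mem_insert.1 ha with rfl | ha
    · -- the new edge is measured from its own end `a`
      have hc' : G.len e - c = 0 ∨ G.len e - c = G.len e := by
        rcases hc with rfl | rfl <;> simp
      have ha0 := distInt_le_of_end hG hc' (.vertex a)
      have h0 : G.dist (.vertex a) (.vertex a) = 0 :=
        le_antisymm (dist_le_of_hasPath (HasPath.refl _)) (dist_nonneg _ _)
      rw [hcw, h0] at ha0
      have hS : ∑ f ∈ S, G.distInt (.vertex a) f ≤ G.len e * ℓ S + ℓ S ^ 2 / 2 :=
        calc _ ≤ ∑ f ∈ S, (G.len e * G.len f + G.distInt (.vertex v) f) :=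
              Finset.sum_le_sum fun f _ => (distInt_triangle hG _ (.vertex v) f).trans (by
                have := G.len_nonneg f
                gcongr)
          _ ≤ _ := by
              rw [Finset.sum_add_distrib, ← Finset.mul_sum]
              gcongr
      nlinarith
    · have h := distInt_le_of_end hG hc (.vertex a)
      rw [hcv] at h
      have := h1 a ha v hv
      have := h2 a ha
      nlinarith
  · rw [hins, Finset.sum_insert he, Finset.sum_insert he]
    simp_rw [Finset.sum_insert he, Finset.sum_add_distrib]
    have hself := distIntInt_self_le hG e
    have hleft : ∑ f ∈ S, G.distIntInt e f ≤ G.len e ^ 2 / 2 * ℓ S + G.len e * (ℓ S ^ 2 / 2) :=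
      calc _ ≤ ∑ f ∈ S, (G.len e ^ 2 / 2 * G.len f + G.len e * G.distInt (.vertex v) f) :=
            Finset.sum_le_sum fun f _ => by rw [← hcv]; exact distIntInt_le_left hG hc f
        _ ≤ _ := by
            rw [Finset.sum_add_distrib, ← Finset.mul_sum, ← Finset.mul_sum]
            gcongr
    have hright : ∑ f ∈ S, G.distIntInt f e ≤ G.len e ^ 2 / 2 * ℓ S + G.len e * (ℓ S ^ 2 / 2) :=
      calc _ ≤ ∑ f ∈ S, (G.len e ^ 2 / 2 * G.len f + G.len e * G.distInt (.vertex v) f) :=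
            Finset.sum_le_sum fun f _ => by rw [← hcv]; exact distIntInt_le_right hG hc f
        _ ≤ _ := by
            rw [Finset.sum_add_distrib, ← Finset.mul_sum, ← Finset.mul_sum]
            gcongr
    nlinarith

theorem meanDist_le_third [Fintype V] [Fintype E] [Nonempty E] (hG : G.Connected) :
    G.meanDist ≤ G.totalLength / 3 := by
  have hL := G.totalLength_pos
  rw [hG.meanDist_eq, ← mul_assoc, div_mul_div_comm, one_mul, div_mul_eq_mul_div, one_mul,
    div_le_iff₀ (by positivity)]
  exact (sum_distIntInt_le hG).trans (le_of_eq (by ring))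

/-! ### A lower bound for the mean distance -/

/-- The distance of `t ∈ [0, l]` to the boundary of the interval; equivalently, the distance of `t`
to `0` on a circle of length `l`. -/
noncomputable def tent (l t : ℝ) : ℝ := min t (l - t)

theorem tent_sub_le (l x y : ℝ) : tent l x - tent l y ≤ |x - y| := by
  unfold tent
  have h1 := le_abs_self (x - y)
  have h2 := neg_abs_le (x - y)
  rcases min_cases y (l - y) with h | h <;> rw [h.1]
  · linarith [min_le_left x (l - x)]
  · linarith [min_le_right x (l - x)]

theorem continuous_tent (l : ℝ) : Continuous (tent l) :=
  continuous_id.min (continuous_const.sub continuous_id)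

theorem tent_sub_self (l t : ℝ) : tent l (l - t) = tent l t := by
  unfold tent
  rw [sub_sub_cancel, min_comm]

theorem tent_zero {l : ℝ} (hl : 0 ≤ l) : tent l 0 = 0 := by
  simp [tent, hl]

theorem tent_self {l : ℝ} (hl : 0 ≤ l) : tent l l = 0 := by
  simp [tent, hl]

theorem integral_tent {l : ℝ} (hl : 0 ≤ l) : ∫ t in (0 : ℝ)..l, tent l t = l ^ 2 / 4 := by
  have hc := continuous_tent l
  have h1 : ∫ t in (0 : ℝ)..(l / 2), tent l t = l ^ 2 / 8 := by
    rw [intervalIntegral.integral_congr (g := fun t => t) fun t ht => ?_]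
    · rw [integral_id]; ring
    · rw [Set.uIcc_of_le (by linarith)] at ht
      exact min_eq_left (by linarith [ht.2])
  have h2 : ∫ t in (l / 2)..l, tent l t = l ^ 2 / 8 := by
    rw [← h1]
    have := intervalIntegral.integral_comp_sub_left (a := l / 2) (b := l) (tent l) l
    simp only [tent_sub_self, sub_self] at this
    rw [this]
    congr 1
    ring
  rw [← intervalIntegral.integral_add_adjacent_intervals (hc.intervalIntegrable 0 (l / 2))
    (hc.intervalIntegrable (l / 2) l), h1, h2]
  ring

/-- The mean of the circle distance to the point `s` does not depend on `s`. -/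
theorem integral_tent_abs_sub {l s : ℝ} (hs : s ∈ Set.Icc 0 l) :
    ∫ t in (0 : ℝ)..l, tent l |t - s| = l ^ 2 / 4 := by
  have hl : 0 ≤ l := hs.1.trans hs.2
  have hc := continuous_tent l
  have hc' : Continuous fun t : ℝ => tent l |t - s| := hc.comp (by fun_prop)
  have h1 : ∫ t in (0 : ℝ)..s, tent l |t - s| = ∫ t in (0 : ℝ)..s, tent l t := by
    rw [intervalIntegral.integral_congr (g := fun t => tent l (s - t)) fun t ht => ?_]
    · simp [intervalIntegral.integral_comp_sub_left (tent l) s]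
    · rw [Set.uIcc_of_le hs.1] at ht
      simp only [abs_sub_comm t s, abs_of_nonneg (sub_nonneg.2 ht.2)]
  have h2 : ∫ t in s..l, tent l |t - s| = ∫ t in s..l, tent l t := by
    rw [intervalIntegral.integral_congr (g := fun t => tent l (l - (t - s))) fun t ht => ?_]
    · have := intervalIntegral.integral_comp_sub_left (a := s) (b := l) (tent l) (l + s)
      rw [show l + s - s = l by ring, show l + s - l = s by ring] at this
      rw [← this]
      congr 1 with t
      congr 1
      ring
    · rw [Set.uIcc_of_le hs.2] at ht
      simp only [tent_sub_self, abs_of_nonneg (sub_nonneg.2 ht.1)]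
  rw [← intervalIntegral.integral_add_adjacent_intervals (hc'.intervalIntegrable 0 s)
    (hc'.intervalIntegrable s l), h1, h2, intervalIntegral.integral_add_adjacent_intervals
    (hc.intervalIntegrable 0 s) (hc.intervalIntegrable s l), integral_tent hl]

/-- Identifying all vertices does not increase distances: the distance in the resulting bouquet of
circles, on the left-hand side, is a lower bound for the distance in the graph. -/
theorem le_dist_bouquet [DecidableEq E] (hG : G.Connected) {e f : E} {s t : ℝ}
    (hs : s ∈ Set.Icc 0 (G.len e)) (ht : t ∈ Set.Icc 0 (G.len f)) :
    (if f = e then tent (G.len e) |t - s| else tent (G.len e) s + tent (G.len f) t)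
      ≤ G.dist (G.pt e s) (G.pt f t) := by
  set F : E → ℝ → ℝ := fun f t =>
    if f = e then tent (G.len e) |t - s| else tent (G.len e) s + tent (G.len f) t with hF
  have h0 : ∀ f, F f 0 = tent (G.len e) s := fun f => by
    by_cases hf : f = e
    · simp [hF, hf, abs_of_nonneg hs.1]
    · simp only [hF, hf, if_false]
      rw [tent_zero (G.len_nonneg f), add_zero]
  have h1 : ∀ f, F f (G.len f) = tent (G.len e) s := fun f => by
    by_cases hf : f = e
    · subst hf
      simp [hF, abs_of_nonneg (sub_nonneg.2 hs.2), tent_sub_self]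
    · simp only [hF, hf, if_false]
      rw [tent_self (G.len_nonneg f), add_zero]
  have hg : ∀ f, ∀ t ∈ Set.Icc 0 (G.len f),
      G.glue (fun _ => tent (G.len e) s) F (G.pt f t) = F f t := fun f t ht =>
    glue_pt (h0 f) (h1 f) ht
  refine hG.le_dist fun r hr => ?_
  have := HasPath.sub_le (Φ := G.glue (fun _ => tent (G.len e) s) F) (fun f x hx y hy => ?_) hr
  · rw [hg f t ht, hg e s hs] at this
    have hz : F e s = 0 := by
      simp [hF, tent_zero (G.len_nonneg e)]
    linarith
  · rw [hg f x hx, hg f y hy]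
    by_cases hf : f = e
    · simp only [hF, hf, if_true]
      refine (tent_sub_le _ _ _).trans ((abs_abs_sub_abs_le_abs_sub _ _).trans (le_of_eq ?_))
      congr 1
      ring
    · simp only [hF, hf, if_false, add_sub_add_left_eq_sub]
      exact tent_sub_le _ _ _

theorem le_distIntInt [DecidableEq E] (hG : G.Connected) (e f : E) :
    (G.len e ^ 2 * G.len f + G.len e * G.len f ^ 2) / 4 - (if f = e then G.len e ^ 3 / 4 else 0)
      ≤ G.distIntInt e f := by
  have hle := G.len_nonneg e
  have hlf := G.len_nonneg f
  by_cases hf : f = e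
  · subst hf
    have h1 : ∀ s ∈ Set.Icc 0 (G.len f), G.len f ^ 2 / 4 ≤ G.distInt (G.pt f s) f := fun s hs => by
      rw [← integral_tent_abs_sub hs]
      refine integral_mono_edge ((continuous_tent _).comp (by fun_prop)).continuousOn
        (hG.continuousOn_dist _ f) fun t ht => ?_
      simpa using le_dist_bouquet hG hs ht
    refine le_trans (le_of_eq ?_)
      (integral_mono_edge continuousOn_const (hG.continuousOn_distInt f f) h1)
    simp only [if_true, intervalIntegral.integral_const, smul_eq_mul]
    ring
  · have h1 : ∀ s ∈ Set.Icc 0 (G.len e),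
        tent (G.len e) s * G.len f + G.len f ^ 2 / 4 ≤ G.distInt (G.pt e s) f := fun s hs => by
      refine le_trans (le_of_eq ?_) (integral_mono_edge
        (f := fun t => tent (G.len e) s + tent (G.len f) t)
        (continuous_const.add (continuous_tent _)).continuousOn
        (hG.continuousOn_dist _ f) fun t ht => ?_)
      · rw [intervalIntegral.integral_add (by simp) ((continuous_tent _).intervalIntegrable _ _),
          integral_tent hlf]
        simp [mul_comm]
      · simpa [hf] using le_dist_bouquet hG hs ht
    have hc : Continuous fun s => tent (G.len e) s * G.len f :=
      (continuous_tent _).mul continuous_const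
    refine le_trans (le_of_eq ?_) (integral_mono_edge
      (f := fun s => tent (G.len e) s * G.len f + G.len f ^ 2 / 4)
      (hc.add continuous_const).continuousOn (hG.continuousOn_distInt f e) h1)
    rw [intervalIntegral.integral_add (hc.intervalIntegrable _ _) (by simp),
      intervalIntegral.integral_mul_const, integral_tent hle]
    simp only [hf, if_false, intervalIntegral.integral_const, smul_eq_mul]
    ring

/-- The sum of the functions `L x² / 2 - x³ / 4` of nonnegative numbers with sum `L` is smallest
when they are equal: the function lies above its tangent line at the mean value. -/
theorem sum_sq_sub_cube_ge {ι : Type*} [Fintype ι] [Nonempty ι] (x : ι → ℝ) (hx : ∀ i, 0 ≤ x i) :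
    (∑ i, x i) ^ 3 * (2 * (Fintype.card ι : ℝ) - 1) / (4 * (Fintype.card ι : ℝ) ^ 2)
      ≤ ∑ i, ((∑ j, x j) * x i ^ 2 / 2 - x i ^ 3 / 4) := by
  set L := ∑ i, x i with hL
  set n : ℝ := (Fintype.card ι : ℝ) with hn
  have hnpos : 0 < n := by rw [hn]; exact_mod_cast Fintype.card_pos
  have hxL : ∀ i, x i ≤ L := fun i => Finset.single_le_sum (fun j _ => hx j) (Finset.mem_univ i)
  have hLn : 0 ≤ L := Finset.sum_nonneg fun i _ => hx i
  have key : ∀ i, L * (L / n) ^ 2 / 2 - (L / n) ^ 3 / 4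
      + (L * (L / n) - 3 / 4 * (L / n) ^ 2) * (x i - L / n) ≤ L * x i ^ 2 / 2 - x i ^ 3 / 4 := by
    intro i
    have hfac : 0 ≤ (x i - L / n) ^ 2 * (L / 2 - (x i + 2 * (L / n)) / 4) := by
      rcases Nat.lt_or_ge 1 (Fintype.card ι) with h | h
      · refine mul_nonneg (sq_nonneg _) ?_
        have h2 : (2 : ℝ) ≤ n := by rw [hn]; exact_mod_cast h
        have : L / n ≤ L / 2 := by gcongr
        linarith [hxL i]
      · have h1 : Fintype.card ι = 1 := le_antisymm h Fintype.card_pos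
        have hi : x i = L / n := by
          obtain ⟨j, hj⟩ := Fintype.card_eq_one_iff.1 h1
          have : ∀ k, x k = x i := fun k => by rw [hj k, hj i]
          rw [hL, Finset.sum_congr rfl fun k _ => this k]
          simp [hn, h1]
        simp [hi]
    nlinarith
  calc _ = ∑ i, (L * (L / n) ^ 2 / 2 - (L / n) ^ 3 / 4
      + (L * (L / n) - 3 / 4 * (L / n) ^ 2) * (x i - L / n)) := by
        have hz : ∑ i, (x i - L / n) = 0 := by
          rw [Finset.sum_sub_distrib, ← hL]
          simp only [Finset.sum_const, Finset.card_univ, nsmul_eq_mul, ← hn]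
          field_simp
          ring
        rw [Finset.sum_add_distrib, ← Finset.mul_sum, hz]
        simp only [Finset.sum_const, Finset.card_univ, nsmul_eq_mul, ← hn]
        field_simp
        ring
    _ ≤ _ := Finset.sum_le_sum fun i _ => key i

theorem le_meanDist [Fintype E] [Nonempty E] (hG : G.Connected) :
    G.totalLength * (2 * (Fintype.card E : ℝ) - 1) / (4 * (Fintype.card E : ℝ) ^ 2)
      ≤ G.meanDist := by
  classical
  have hL := G.totalLength_pos
  rw [hG.meanDist_eq, ← mul_assoc, div_mul_div_comm, one_mul, div_mul_eq_mul_div, one_mul,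
    le_div_iff₀ (by positivity)]
  have h1 : ∑ e, (G.totalLength * G.len e ^ 2 / 2 - G.len e ^ 3 / 4)
      ≤ ∑ e, ∑ f, G.distIntInt e f := by
    refine le_trans (le_of_eq ?_)
      (Finset.sum_le_sum fun e _ => Finset.sum_le_sum fun f _ => le_distIntInt hG e f)
    have hin : ∀ e, ∑ f, ((G.len e ^ 2 * G.len f + G.len e * G.len f ^ 2) / 4
        - if f = e then G.len e ^ 3 / 4 else 0)
        = (G.len e ^ 2 * G.totalLength + G.len e * ∑ f, G.len f ^ 2) / 4 - G.len e ^ 3 / 4 := by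
      intro e
      rw [Finset.sum_sub_distrib, Finset.sum_ite_eq', if_pos (Finset.mem_univ e),
        ← Finset.sum_div, Finset.sum_add_distrib, ← Finset.mul_sum, ← Finset.mul_sum, totalLength]
    rw [Finset.sum_congr rfl fun e _ => hin e, Finset.sum_sub_distrib, Finset.sum_sub_distrib,
      ← Finset.sum_div, ← Finset.sum_div, ← Finset.sum_div, Finset.sum_add_distrib,
      ← Finset.sum_mul, ← Finset.sum_mul, ← Finset.mul_sum]
    change _ = (_ + G.totalLength * _) / 4 - _
    ring
  refine le_trans (le_of_eq ?_)
    ((sum_sq_sub_cube_ge G.len fun e => G.len_nonneg e).trans h1)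
  rw [totalLength]
  ring

theorem meanDist_pos [Fintype E] [Nonempty E] (hG : G.Connected) : 0 < G.meanDist := by
  refine lt_of_lt_of_le ?_ (le_meanDist hG)
  have hL := G.totalLength_pos
  have h1 : (1 : ℝ) ≤ Fintype.card E := by exact_mod_cast Fintype.card_pos
  have : 0 < 2 * (Fintype.card E : ℝ) - 1 := by linarith
  positivity

/-! ### Test functions for the spectral gap -/

theorem integral_sq_nonneg (f : ℝ → ℝ) (e : E) : 0 ≤ ∫ x in (0 : ℝ)..(G.len e), f x ^ 2 :=
  intervalIntegral.integral_nonneg (G.len_nonneg e) fun _ _ => sq_nonneg _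

theorem rayleigh_nonneg [Fintype E] (G : MetricGraph V E) (u : G.Space → ℝ) (g : E → ℝ → ℝ) :
    0 ≤ (∑ e, ∫ x in (0 : ℝ)..(G.len e), g e x ^ 2) / G.integral (fun p => u p ^ 2) :=
  div_nonneg (Finset.sum_nonneg fun _ _ => integral_sq_nonneg _ _)
    (Finset.sum_nonneg fun e _ => integral_sq_nonneg (fun x => u (G.pt e x)) e)

theorem spectralGap_nonneg [Fintype E] (G : MetricGraph V E) : 0 ≤ G.spectralGap := by
  refine Real.sInf_nonneg ?_
  rintro q ⟨u, g, -, -, -, rfl⟩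
  exact rayleigh_nonneg G u g

theorem spectralGap_le_rayleigh [Fintype E] {u : G.Space → ℝ} {g : E → ℝ → ℝ} (h : G.IsH1 u g)
    (h0 : G.integral u = 0) (h1 : G.integral (fun p => u p ^ 2) ≠ 0) :
    G.spectralGap ≤
      (∑ e, ∫ x in (0 : ℝ)..(G.len e), g e x ^ 2) / G.integral (fun p => u p ^ 2) := by
  refine csInf_le ⟨0, ?_⟩ ⟨u, g, h, h0, h1, rfl⟩
  rintro q ⟨u, g, -, -, -, rfl⟩
  exact rayleigh_nonneg G u g

/-- Edgewise continuously differentiable functions that agree at the vertices define an element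
of `H¹`. -/
theorem isH1_glue {a : V → ℝ} {f f' : E → ℝ → ℝ} (hd : ∀ e x, HasDerivAt (f e) (f' e x) x)
    (hc : ∀ e, Continuous (f' e)) (h0 : ∀ e, f e 0 = a (G.src e))
    (h1 : ∀ e, f e (G.len e) = a (G.tgt e)) : G.IsH1 (G.glue a f) f' where
  continuousOn e := by
    have : Continuous (f e) := continuous_iff_continuousAt.2 fun x => (hd e x).continuousAt
    exact this.continuousOn.congr fun x hx => glue_pt (h0 e) (h1 e) hx
  memLp e := by
    obtain ⟨C, hC⟩ := isCompact_Icc.exists_bound_of_continuousOn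
      (hc e).continuousOn (s := Set.Icc 0 (G.len e))
    refine MemLp.of_bound (hc e).aestronglyMeasurable C ?_
    filter_upwards [ae_restrict_mem measurableSet_Ioo] with x hx using
      hC x (Set.Ioo_subset_Icc_self hx)
  weakDeriv e φ hφ hcs hsupp := by
    have hz : ∀ x, x ∉ Set.Ioo 0 (G.len e) → φ x = 0 := fun x hx =>
      image_eq_zero_of_notMem_tsupport fun h => hx (hsupp h)
    have hφd : ∀ x, HasDerivAt φ (deriv φ x) x := fun x =>
      (hφ.differentiable (by simp) x).hasDerivAt
    have hφc : Continuous (deriv φ) := hφ.continuous_deriv (by simp)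
    rw [intervalIntegral.integral_congr (g := fun x => f e x * deriv φ x) fun x hx => ?_]
    · rw [intervalIntegral.integral_mul_deriv_eq_deriv_mul (fun x _ => hd e x) (fun x _ => hφd x)
        ((hc e).intervalIntegrable _ _) (hφc.intervalIntegrable _ _), hz 0 (by simp),
        hz (G.len e) (by simp)]
      simp
    · rw [Set.uIcc_of_le (G.len_nonneg e)] at hx
      simp only [glue_pt (h0 e) (h1 e) hx]

theorem integral_glue [Fintype E] {a : V → ℝ} {f : E → ℝ → ℝ} (h0 : ∀ e, f e 0 = a (G.src e))
    (h1 : ∀ e, f e (G.len e) = a (G.tgt e)) (Φ : ℝ → ℝ) :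
    G.integral (fun p => Φ (G.glue a f p)) = ∑ e, ∫ x in (0 : ℝ)..(G.len e), Φ (f e x) := by
  refine Finset.sum_congr rfl fun e _ => intervalIntegral.integral_congr fun x hx => ?_
  rw [Set.uIcc_of_le (G.len_nonneg e)] at hx
  simp only [glue_pt (h0 e) (h1 e) hx]

/-- Upper bound for the spectral gap by the Rayleigh quotient of a test function after
subtraction of its mean value. -/
theorem spectralGap_le_of_test [Fintype E] [Nonempty E] {a : V → ℝ} {f f' : E → ℝ → ℝ} {c : ℝ}
    (hd : ∀ e x, HasDerivAt (f e) (f' e x) x) (hc : ∀ e, Continuous (f' e))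
    (h0 : ∀ e, f e 0 = a (G.src e)) (h1 : ∀ e, f e (G.len e) = a (G.tgt e))
    (hpos : 0 < (∑ e, ∫ x in (0 : ℝ)..(G.len e), f e x ^ 2)
      - (∑ e, ∫ x in (0 : ℝ)..(G.len e), f e x) ^ 2 / G.totalLength)
    (hle : ∑ e, ∫ x in (0 : ℝ)..(G.len e), f' e x ^ 2
      ≤ c * ((∑ e, ∫ x in (0 : ℝ)..(G.len e), f e x ^ 2)
      - (∑ e, ∫ x in (0 : ℝ)..(G.len e), f e x) ^ 2 / G.totalLength)) :
    G.spectralGap ≤ c := by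
  have hL := G.totalLength_pos
  set S1 := ∑ e, ∫ x in (0 : ℝ)..(G.len e), f e x with hS1
  set S2 := ∑ e, ∫ x in (0 : ℝ)..(G.len e), f e x ^ 2 with hS2
  set m := S1 / G.totalLength with hm
  have hcont : ∀ e, Continuous (f e) := fun e =>
    continuous_iff_continuousAt.2 fun x => (hd e x).continuousAt
  have hint : ∀ e, IntervalIntegrable (f e) volume 0 (G.len e) := fun e =>
    (hcont e).intervalIntegrable _ _
  have h0' : ∀ e, f e 0 - m = a (G.src e) - m := fun e => by rw [h0]
  have h1' : ∀ e, f e (G.len e) - m = a (G.tgt e) - m := fun e => by rw [h1]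
  have hH : G.IsH1 (G.glue (fun v => a v - m) fun e x => f e x - m) f' :=
    isH1_glue (fun e x => (hd e x).sub_const m) hc h0' h1'
  have hI0 := integral_glue (a := fun v => a v - m) (f := fun e x => f e x - m) h0' h1' fun t => t
  have hI1 := integral_glue (a := fun v => a v - m) (f := fun e x => f e x - m) h0' h1'
    fun t => t ^ 2
  have e0 : ∑ e, ∫ x in (0 : ℝ)..(G.len e), (f e x - m) = 0 := by
    have : ∀ e, ∫ x in (0 : ℝ)..(G.len e), (f e x - m)
        = (∫ x in (0 : ℝ)..(G.len e), f e x) - G.len e * m := fun e => by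
      rw [intervalIntegral.integral_sub (hint e) (by simp)]
      simp
    rw [Finset.sum_congr rfl fun e _ => this e, Finset.sum_sub_distrib, ← Finset.sum_mul, ← hS1]
    change S1 - G.totalLength * m = 0
    rw [hm]
    field_simp
    ring
  have e1 : ∑ e, ∫ x in (0 : ℝ)..(G.len e), (f e x - m) ^ 2 = S2 - S1 ^ 2 / G.totalLength := by
    have : ∀ e, ∫ x in (0 : ℝ)..(G.len e), (f e x - m) ^ 2
        = (∫ x in (0 : ℝ)..(G.len e), f e x ^ 2) - 2 * m * (∫ x in (0 : ℝ)..(G.len e), f e x)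
          + G.len e * m ^ 2 := fun e => by
      have hsq : IntervalIntegrable (fun x => f e x ^ 2) volume 0 (G.len e) :=
        ((hcont e).pow 2).intervalIntegrable _ _
      have hmul : IntervalIntegrable (fun x => 2 * m * f e x) volume 0 (G.len e) :=
        (hint e).const_mul _
      rw [← intervalIntegral.integral_const_mul, ← intervalIntegral.integral_sub hsq hmul,
        show G.len e * m ^ 2 = ∫ x in (0 : ℝ)..(G.len e), m ^ 2 by simp,
        ← intervalIntegral.integral_add (hsq.sub hmul) (by simp)]
      congr 1 with x
      ring
    rw [Finset.sum_congr rfl fun e _ => this e, Finset.sum_add_distrib, Finset.sum_sub_distrib,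
      ← Finset.sum_mul, ← Finset.mul_sum, ← hS1, ← hS2]
    change S2 - 2 * m * S1 + G.totalLength * m ^ 2 = _
    rw [hm]
    field_simp
    ring
  rw [e0] at hI0
  rw [e1] at hI1
  refine (spectralGap_le_rayleigh hH hI0 (by rw [hI1]; exact hpos.ne')).trans ?_
  rwa [hI1, div_le_iff₀ hpos]

theorem integral_cos_mul_sub_half {κ : ℝ} (hκ : κ ≠ 0) (l : ℝ) :
    ∫ x in (0 : ℝ)..l, Real.cos (κ * (x - l / 2)) = 2 * Real.sin (κ * l / 2) / κ := by
  have hd : ∀ x, HasDerivAt (fun x => Real.sin (κ * (x - l / 2)) / κ)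
      (Real.cos (κ * (x - l / 2))) x := fun x => by
    have := ((((hasDerivAt_id x).sub_const (l / 2)).const_mul κ).sin).div_const κ
    refine this.congr_deriv ?_
    rw [mul_one, mul_div_cancel_right₀ _ hκ]
    rfl
  rw [intervalIntegral.integral_eq_sub_of_hasDerivAt (fun x _ => hd x)
    (Continuous.intervalIntegrable (by fun_prop) _ _),
    show κ * (0 - l / 2) = -(κ * l / 2) by ring, show κ * (l - l / 2) = κ * l / 2 by ring,
    Real.sin_neg]
  ring

theorem integral_cos_sq_mul_sub_half {κ : ℝ} (hκ : κ ≠ 0) (l : ℝ) :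
    ∫ x in (0 : ℝ)..l, Real.cos (κ * (x - l / 2)) ^ 2
      = l / 2 + Real.sin (κ * l) / (2 * κ) := by
  have h : ∀ x, Real.cos (κ * (x - l / 2)) ^ 2
      = 1 / 2 + 1 / 2 * Real.cos (2 * κ * (x - l / 2)) := fun x => by
    rw [Real.cos_sq, mul_assoc]
    ring
  have hc : Continuous fun x : ℝ => 1 / 2 * Real.cos (2 * κ * (x - l / 2)) := by fun_prop
  simp_rw [h]
  rw [intervalIntegral.integral_add (by simp) (hc.intervalIntegrable _ _),
    intervalIntegral.integral_const_mul, integral_cos_mul_sub_half (by positivity)]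
  rw [show 2 * κ * l / 2 = κ * l by ring]
  simp only [intervalIntegral.integral_const, smul_eq_mul]
  field_simp
  ring

theorem integral_sin_sq_mul_sub_half {κ : ℝ} (hκ : κ ≠ 0) (l : ℝ) :
    ∫ x in (0 : ℝ)..l, Real.sin (κ * (x - l / 2)) ^ 2
      = l / 2 - Real.sin (κ * l) / (2 * κ) := by
  simp_rw [Real.sin_sq]
  have hc : Continuous fun x : ℝ => Real.cos (κ * (x - l / 2)) ^ 2 := by fun_prop
  rw [intervalIntegral.integral_sub (by simp) (hc.intervalIntegrable _ _),
    integral_cos_sq_mul_sub_half hκ]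
  simp only [intervalIntegral.integral_const, smul_eq_mul]
  ring

theorem sum_eq_add_add_sum_erase [Fintype E] [DecidableEq E] {i j : E} (hij : i ≠ j) (h : E → ℝ) :
    ∑ e, h e = h i + h j + ∑ e ∈ (Finset.univ.erase i).erase j, h e := by
  rw [add_assoc, Finset.add_sum_erase _ h (by simp [hij.symm]),
    Finset.add_sum_erase _ h (Finset.mem_univ i)]

/-- Two edges of total length `ℓᵢ + ℓⱼ` give the bound `(2π / (ℓᵢ + ℓⱼ))²` for the spectral gap.
The test function is a cosine of that period on the circle obtained from the two edges,
positioned so that it has the same value `b` at both places where the edges meet; it is continued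
by the constant `b`. -/
theorem spectralGap_le_of_two_edges [Fintype E] {i j : E} (hij : i ≠ j) :
    G.spectralGap ≤ (2 * Real.pi / (G.len i + G.len j)) ^ 2 := by
  classical
  have : Nonempty E := ⟨i⟩
  have hi := G.len_pos i
  have hj := G.len_pos j
  have hpi := Real.pi_pos
  set κ := 2 * Real.pi / (G.len i + G.len j) with hκ
  have hκpos : 0 < κ := by positivity
  have hsum : κ * (G.len i + G.len j) = 2 * Real.pi := by rw [hκ]; field_simp
  set b := Real.cos (κ * (G.len i / 2)) with hb
  have hbj : b = -Real.cos (κ * (G.len j / 2)) := by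
    rw [hb, ← Real.cos_pi_sub]
    congr 1
    linarith
  let f : E → ℝ → ℝ := fun e x =>
    if e = i then Real.cos (κ * (x - G.len i / 2))
    else if e = j then -Real.cos (κ * (x - G.len j / 2)) else b
  let f' : E → ℝ → ℝ := fun e x =>
    if e = i then -Real.sin (κ * (x - G.len i / 2)) * κ
    else if e = j then Real.sin (κ * (x - G.len j / 2)) * κ else 0
  have hd0 : ∀ l x : ℝ, HasDerivAt (fun x => Real.cos (κ * (x - l / 2)))
      (-Real.sin (κ * (x - l / 2)) * κ) x := fun l x => by
    simpa using (((hasDerivAt_id x).sub_const (l / 2)).const_mul κ).cos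
  have hd : ∀ e x, HasDerivAt (f e) (f' e x) x := by
    intro e x
    by_cases h : e = i
    · simpa only [f, f', h, if_true] using hd0 (G.len i) x
    by_cases h' : e = j
    · simp only [f, f', h', hij.symm, if_true, if_false]
      exact (hd0 (G.len j) x).neg.congr_deriv (by ring)
    · simpa only [f, f', h, h', if_false] using hasDerivAt_const x b
  have hc : ∀ e, Continuous (f' e) := by
    intro e
    by_cases h : e = i
    · simp only [f', h, if_true]; fun_prop
    by_cases h' : e = j
    · simp only [f', h', hij.symm, if_true, if_false]; fun_prop
    · simp only [f', h, h', if_false]; fun_prop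
  have h0 : ∀ e, f e 0 = (fun _ : V => b) (G.src e) := by
    intro e
    by_cases h : e = i
    · simp [f, h, hb]
    by_cases h' : e = j
    · simp [f, h', hij.symm, hbj]
    · simp [f, h, h']
  have h1 : ∀ e, f e (G.len e) = (fun _ : V => b) (G.tgt e) := by
    intro e
    by_cases h : e = i
    · simp only [f, h, if_true, hb]; congr 2; ring
    by_cases h' : e = j
    · simp only [f, h', hij.symm, if_true, if_false, hbj]; congr 3; ring
    · simp [f, h, h']
  set R := (Finset.univ.erase i).erase j with hR
  have hne : ∀ e ∈ R, e ≠ i ∧ e ≠ j := fun e he => by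
    simp only [hR, Finset.mem_erase] at he
    exact ⟨he.2.1, he.1⟩
  set r := ∑ e ∈ R, G.len e with hr
  have hr0 : 0 ≤ r := Finset.sum_nonneg fun e _ => G.len_nonneg e
  have hL : G.totalLength = G.len i + G.len j + r := sum_eq_add_add_sum_erase hij G.len
  have hsin1 : Real.sin (κ * G.len i / 2) = Real.sin (κ * G.len j / 2) := by
    rw [← Real.sin_pi_sub]; congr 1; linarith
  have hsin2 : Real.sin (κ * G.len i) = -Real.sin (κ * G.len j) := by
    rw [← Real.sin_two_pi_sub]; congr 1; linarith
  have S1 : ∑ e, ∫ x in (0 : ℝ)..(G.len e), f e x = b * r := by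
    rw [sum_eq_add_add_sum_erase hij, Finset.sum_congr rfl fun e he =>
      show ∫ x in (0 : ℝ)..(G.len e), f e x = b * G.len e by
        simp [f, (hne e he).1, (hne e he).2, mul_comm], ← Finset.mul_sum]
    simp only [f, hij.symm, if_true, if_false, intervalIntegral.integral_neg]
    rw [integral_cos_mul_sub_half hκpos.ne', integral_cos_mul_sub_half hκpos.ne', hsin1]
    ring
  have S2 : ∑ e, ∫ x in (0 : ℝ)..(G.len e), f e x ^ 2
      = (G.len i + G.len j) / 2 + b ^ 2 * r := by
    rw [sum_eq_add_add_sum_erase hij, Finset.sum_congr rfl fun e he =>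
      show ∫ x in (0 : ℝ)..(G.len e), f e x ^ 2 = b ^ 2 * G.len e by
        simp [f, (hne e he).1, (hne e he).2, mul_comm], ← Finset.mul_sum]
    simp only [f, hij.symm, if_true, if_false, neg_sq]
    rw [integral_cos_sq_mul_sub_half hκpos.ne', integral_cos_sq_mul_sub_half hκpos.ne', hsin2]
    ring
  have D : ∑ e, ∫ x in (0 : ℝ)..(G.len e), f' e x ^ 2
      = κ ^ 2 * ((G.len i + G.len j) / 2) := by
    rw [sum_eq_add_add_sum_erase hij, Finset.sum_congr rfl fun e he =>
      show ∫ x in (0 : ℝ)..(G.len e), f' e x ^ 2 = 0 by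
        simp [f', (hne e he).1, (hne e he).2], Finset.sum_const_zero]
    simp only [f', hij.symm, if_true, if_false, neg_sq, mul_pow,
      intervalIntegral.integral_mul_const]
    rw [integral_sin_sq_mul_sub_half hκpos.ne', integral_sin_sq_mul_sub_half hκpos.ne', hsin2]
    ring
  have hvar : (G.len i + G.len j) / 2 ≤
      (G.len i + G.len j) / 2 + b ^ 2 * r - (b * r) ^ 2 / G.totalLength := by
    have : (b * r) ^ 2 / G.totalLength ≤ b ^ 2 * r := by
      rw [div_le_iff₀ G.totalLength_pos, hL]
      nlinarith [mul_nonneg (mul_nonneg (sq_nonneg b) hr0) (add_pos hi hj).le]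
    linarith
  refine spectralGap_le_of_test (a := fun _ => b) hd hc h0 h1 ?_ ?_
  · rw [S1, S2]
    linarith
  · rw [S1, S2, D]
    gcongr

/-- The integral of a cosine with a whole number of half periods. -/
theorem integral_cos_half_periods {r : ℝ} (hr : 0 < r) (k : ℤ) :
    ∫ x in (0 : ℝ)..r, Real.cos (k * Real.pi / r * x) = if k = 0 then r else 0 := by
  split_ifs with hk
  · simp [hk]
  · have hk' : (k : ℝ) ≠ 0 := by exact_mod_cast hk
    have hpi := Real.pi_ne_zero
    have hκ : (k : ℝ) * Real.pi / r ≠ 0 := by positivity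
    rw [intervalIntegral.integral_comp_mul_left (fun x => Real.cos x) hκ, integral_cos, mul_zero,
      Real.sin_zero, div_mul_cancel₀ _ hr.ne', Real.sin_int_mul_pi]
    simp

theorem integral_cos_mul_cos {r : ℝ} (hr : 0 < r) (j k : ℤ) :
    ∫ x in (0 : ℝ)..r, Real.cos (j * Real.pi / r * x) * Real.cos (k * Real.pi / r * x)
      = ((if j - k = 0 then r else 0) + (if j + k = 0 then r else 0)) / 2 := by
  rw [← integral_cos_half_periods hr, ← integral_cos_half_periods hr,
    ← intervalIntegral.integral_add (Continuous.intervalIntegrable (by fun_prop) _ _)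
      (Continuous.intervalIntegrable (by fun_prop) _ _), ← intervalIntegral.integral_div]
  congr 1 with x
  push_cast
  rw [show ((j : ℝ) - k) * Real.pi / r * x = j * Real.pi / r * x - k * Real.pi / r * x by ring,
    show ((j : ℝ) + k) * Real.pi / r * x = j * Real.pi / r * x + k * Real.pi / r * x by ring,
    Real.cos_sub, Real.cos_add]
  ring

theorem integral_sin_mul_sin {r : ℝ} (hr : 0 < r) (j k : ℤ) :
    ∫ x in (0 : ℝ)..r, Real.sin (j * Real.pi / r * x) * Real.sin (k * Real.pi / r * x)
      = ((if j - k = 0 then r else 0) - (if j + k = 0 then r else 0)) / 2 := by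
  rw [← integral_cos_half_periods hr, ← integral_cos_half_periods hr,
    ← intervalIntegral.integral_sub (Continuous.intervalIntegrable (by fun_prop) _ _)
      (Continuous.intervalIntegrable (by fun_prop) _ _), ← intervalIntegral.integral_div]
  congr 1 with x
  push_cast
  rw [show ((j : ℝ) - k) * Real.pi / r * x = j * Real.pi / r * x - k * Real.pi / r * x by ring,
    show ((j : ℝ) + k) * Real.pi / r * x = j * Real.pi / r * x + k * Real.pi / r * x by ring,
    Real.cos_sub, Real.cos_add]
  ring

theorem Connected.src_ne_tgt [Fintype V] [Fintype E] (hG : G.Connected)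
    (hE : Fintype.card E = 1) (hloop : ¬ G.IsLoop) (e : E) : G.src e ≠ G.tgt e := by
  intro h
  refine hloop ⟨hE, ?_⟩
  obtain ⟨e', he'⟩ := Fintype.card_eq_one_iff.1 hE
  obtain ⟨v⟩ := hG.1
  refine Fintype.card_eq_one_iff.2 ⟨v, fun w => ?_⟩
  have := hG.2 w v
  induction this with
  | rel a b h' => obtain ⟨f, rfl, rfl⟩ := h'; rw [he' f, ← he' e, h]
  | refl a => rfl
  | symm a b _ ih => exact ih.symm
  | trans a b c _ _ ih ih' => exact ih.trans ih'

/-- The bound for an interval, by the first nonconstant cosine. -/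
theorem spectralGap_le_of_single_edge [Fintype V] [Fintype E] [Nonempty E] (hG : G.Connected)
    (hE : Fintype.card E = 1) (hloop : ¬ G.IsLoop) :
    G.spectralGap ≤ (Real.pi / G.totalLength) ^ 2 := by
  classical
  obtain ⟨e, he⟩ := Fintype.card_eq_one_iff.1 hE
  have hsum : ∀ h : E → ℝ, ∑ x, h x = h e := fun h =>
    Fintype.sum_eq_single e fun x hx => absurd (he x) hx
  have hL : G.totalLength = G.len e := hsum _
  have hne := hG.src_ne_tgt hE hloop e
  have hl := G.len_pos e
  set κ := (1 : ℤ) * Real.pi / G.len e with hκ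
  have hd : ∀ x, HasDerivAt (fun x => Real.cos (κ * x)) (-Real.sin (κ * x) * κ) x := fun x => by
    simpa using ((hasDerivAt_id x).const_mul κ).cos
  refine spectralGap_le_of_test (a := fun v => if v = G.src e then 1 else -1)
    (f := fun _ x => Real.cos (κ * x)) (f' := fun _ x => -Real.sin (κ * x) * κ)
    (fun _ x => hd x) (fun _ => by fun_prop) (fun f => ?_) (fun f => ?_) ?_ ?_
  · rw [he f]; simp
  · rw [he f]
    simp [hne.symm, hκ, hl.ne']
  · rw [hsum, hsum, integral_cos_half_periods hl]
    simp_rw [sq, hκ]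
    rw [integral_cos_mul_cos hl]
    norm_num [hl]
  · rw [hsum, hsum, hsum, integral_cos_half_periods hl, hL]
    simp_rw [mul_pow, neg_sq]
    rw [intervalIntegral.integral_mul_const]
    simp_rw [sq (Real.sin _), sq (Real.cos _), hκ]
    rw [integral_cos_mul_cos hl, integral_sin_mul_sin hl]
    norm_num
    exact le_of_eq (by ring)

/-- Two of the edges have at least twice the mean length together. -/
theorem exists_two_edges [Fintype E] (G : MetricGraph V E) (hE : 2 ≤ Fintype.card E) :
    ∃ i j : E, i ≠ j ∧ 2 * G.totalLength / Fintype.card E ≤ G.len i + G.len j := by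
  classical
  by_contra! hcon
  have hn : (2 : ℝ) ≤ Fintype.card E := by exact_mod_cast hE
  have : Nonempty E := Fintype.card_pos_iff.1 (by omega)
  set m := 2 * G.totalLength / Fintype.card E with hm
  -- the mean of `len i + len j` over all pairs of distinct edges is `m`
  have h1 : ∀ i, ∑ j ∈ Finset.univ.erase i, (G.len i + G.len j)
      = (Fintype.card E - 2) * G.len i + G.totalLength := fun i => by
    rw [Finset.sum_add_distrib, Finset.sum_const, Finset.card_erase_of_mem (Finset.mem_univ i),
      Finset.card_univ, nsmul_eq_mul, Nat.cast_sub (by omega)]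
    have := Finset.add_sum_erase Finset.univ G.len (Finset.mem_univ i)
    rw [totalLength]
    push_cast
    linarith
  have h2 : ∑ i, ∑ j ∈ Finset.univ.erase i, (G.len i + G.len j)
      < ∑ i : E, ∑ j ∈ Finset.univ.erase i, m := by
    refine Finset.sum_lt_sum_of_nonempty Finset.univ_nonempty fun i _ =>
      Finset.sum_lt_sum_of_nonempty ?_ fun j hj => hcon i j (Finset.ne_of_mem_erase hj).symm
    rw [← Finset.card_pos, Finset.card_erase_of_mem (Finset.mem_univ i), Finset.card_univ]
    omega
  simp only [h1, Finset.sum_const, Finset.card_erase_of_mem (Finset.mem_univ _), nsmul_eq_mul,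
    Finset.card_univ, Finset.sum_add_distrib, ← Finset.mul_sum] at h2
  rw [Nat.cast_sub (by omega), hm] at h2
  have : (∑ i, G.len i) = G.totalLength := rfl
  rw [this] at h2
  field_simp at h2
  push_cast at h2
  linarith

theorem spectralGap_le_card_edges [Fintype V] [Fintype E] [Nonempty E] (hG : G.Connected)
    (hloop : ¬ G.IsLoop) :
    G.spectralGap ≤ (Real.pi * Fintype.card E / G.totalLength) ^ 2 := by
  have hpi := Real.pi_pos
  have hL := G.totalLength_pos
  rcases Nat.lt_or_ge 1 (Fintype.card E) with h | h
  · obtain ⟨i, j, hij, hle⟩ := G.exists_two_edges h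
    refine (spectralGap_le_of_two_edges hij).trans ?_
    have hn : (0 : ℝ) < Fintype.card E := by exact_mod_cast Fintype.card_pos
    have := G.len_pos i
    have := G.len_pos j
    have h0 : 0 < 2 * G.totalLength / Fintype.card E := by positivity
    calc _ ≤ (2 * Real.pi / (2 * G.totalLength / Fintype.card E)) ^ 2 := by gcongr
      _ = _ := by congr 1; field_simp
  · have h1 : Fintype.card E = 1 := le_antisymm h Fintype.card_pos
    simpa [h1] using spectralGap_le_of_single_edge hG h1 hloop

/-! ### Trees and monotone coordinates along their paths -/

/-- A coordinate along a path of length `r` from `a` to `b` in the part `S` of the graph `T`: a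
function `h` on the vertices which grows from `0` to `r` along the path and is constant off it.
On the edge `e` it has slope `σ e`. The last condition says that the edges of the path
tile the interval `[0, r]`. -/
structure IsPathCoord (T : MetricGraph W E) (S : Finset E) (a b : W) (r : ℝ) (h : W → ℝ)
    (σ : E → ℝ) : Prop where
  start : h a = 0
  finish : h b = r
  slope : ∀ e ∈ S, σ e = -1 ∨ σ e = 0 ∨ σ e = 1
  affine : ∀ e ∈ S, h (T.tgt e) = h (T.src e) + σ e * T.len e
  tile : ∀ F : ℝ → ℝ, Continuous F →
    ∑ e ∈ S, σ e ^ 2 * ∫ x in (0 : ℝ)..(T.len e), F (h (T.src e) + σ e * x)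
      = ∫ x in (0 : ℝ)..r, F x

/-- There is a coordinate along a path of length `r` from `a` to `b`. -/
def HasPathCoord (T : MetricGraph W E) (S : Finset E) (a b : W) (r : ℝ) : Prop :=
  ∃ h σ, T.IsPathCoord S a b r h σ

variable {T : MetricGraph W E} {S : Finset E} {B : Finset W} {a b u w : W} {e : E} {r : ℝ}

theorem HasPathCoord.refl (T : MetricGraph W E) (S : Finset E) (a : W) :
    T.HasPathCoord S a a 0 :=
  ⟨fun _ => 0, fun _ => 0, rfl, rfl, by simp, by simp, by simp⟩

theorem HasPathCoord.symm (h : T.HasPathCoord S a b r) : T.HasPathCoord S b a r := by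
  obtain ⟨h, σ, hσ⟩ := h
  refine ⟨fun v => r - h v, fun e => -σ e, by simp [hσ.finish], by simp [hσ.start], fun e he => ?_,
    fun e he => ?_, fun F hF => ?_⟩
  · rcases hσ.slope e he with h | h | h <;> simp [h]
  · rw [hσ.affine e he]; ring
  · have h1 := hσ.tile (fun x => F (r - x)) (hF.comp (by fun_prop))
    have h2 := intervalIntegral.integral_comp_sub_left (a := 0) (b := r) F r
    rw [sub_self, sub_zero] at h2
    rw [← h2, ← h1]
    refine Finset.sum_congr rfl fun e _ => ?_
    rw [neg_sq]
    congr 2 with x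
    congr 1
    ring

/-- `IsGrownTree s t S B`: the edges in `S`, where `e` has the ends `s e` and `t e`, form a tree
with vertex set `B`, grown from a single vertex by successively attaching edges with a new end. -/
inductive IsGrownTree [DecidableEq W] [DecidableEq E] (s t : E → W) :
    Finset E → Finset W → Prop
  | single (w : W) : IsGrownTree s t ∅ {w}
  | leaf {S : Finset E} {B : Finset W} (e : E) (u w : W) (hT : IsGrownTree s t S B) (he : e ∉ S)
      (hu : u ∈ B) (hw : w ∉ B) (h : s e = u ∧ t e = w ∨ t e = u ∧ s e = w) :
      IsGrownTree s t (insert e S) (insert w B)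

section Tree

variable [DecidableEq W] [DecidableEq E]

theorem IsGrownTree.congr {s t s' t' : E → W} {S : Finset E} {B : Finset W}
    (h : IsGrownTree s t S B) (hs : ∀ e ∈ S, s e = s' e) (ht : ∀ e ∈ S, t e = t' e) :
    IsGrownTree s' t' S B := by
  induction h with
  | single w => exact .single w
  | leaf e u w hT he hu hw h ih =>
    refine .leaf e u w (ih (fun f hf => hs f (Finset.mem_insert_of_mem hf))
      fun f hf => ht f (Finset.mem_insert_of_mem hf)) he hu hw ?_
    rwa [← hs e (Finset.mem_insert_self e _), ← ht e (Finset.mem_insert_self e _)]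

theorem IsGrownTree.ends_mem {s t : E → W} {S : Finset E} {B : Finset W}
    (h : IsGrownTree s t S B) : ∀ e ∈ S, s e ∈ B ∧ t e ∈ B := by
  induction h with
  | single w => simp
  | leaf e u w hT he hu hw h ih =>
    intro f hf
    rcases Finset.mem_insert.1 hf with rfl | hf
    · rcases h with ⟨rfl, rfl⟩ | ⟨rfl, rfl⟩ <;> simp [hu]
    · exact ⟨Finset.mem_insert_of_mem (ih f hf).1, Finset.mem_insert_of_mem (ih f hf).2⟩

/-- Extension of a path coordinate to a new leaf `w`, with the value `y` there. -/
theorem IsPathCoord.update {h : W → ℝ} {σ : E → ℝ} (hσ : T.IsPathCoord S a b r h σ)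
    (hS : ∀ f ∈ S, T.src f ≠ w ∧ T.tgt f ≠ w) (he : e ∉ S) {y τ : ℝ}
    (hτ : τ = -1 ∨ τ = 0 ∨ τ = 1)
    (hy : Function.update h w y (T.tgt e) = Function.update h w y (T.src e) + τ * T.len e) :
    (∀ f ∈ insert e S, Function.update σ e τ f = -1 ∨ Function.update σ e τ f = 0 ∨
      Function.update σ e τ f = 1) ∧
    (∀ f ∈ insert e S, Function.update h w y (T.tgt f)
      = Function.update h w y (T.src f) + Function.update σ e τ f * T.len f) ∧
    ∀ F : ℝ → ℝ, Continuous F →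
      ∑ f ∈ insert e S, Function.update σ e τ f ^ 2 * ∫ x in (0 : ℝ)..(T.len f),
        F (Function.update h w y (T.src f) + Function.update σ e τ f * x)
      = τ ^ 2 * (∫ x in (0 : ℝ)..(T.len e), F (Function.update h w y (T.src e) + τ * x))
        + ∫ x in (0 : ℝ)..r, F x := by
  have hne : ∀ f ∈ S, f ≠ e := fun f hf hfe => he (hfe ▸ hf)
  refine ⟨fun f hf => ?_, fun f hf => ?_, fun F hF => ?_⟩
  · rcases Finset.mem_insert.1 hf with rfl | hf
    · simpa using hτ
    · simpa [hne f hf] using hσ.slope f hf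
  · rcases Finset.mem_insert.1 hf with rfl | hf
    · simpa using hy
    · simpa [hne f hf, (hS f hf).1, (hS f hf).2] using hσ.affine f hf
  · rw [Finset.sum_insert he, ← hσ.tile F hF]
    congr 1
    · simp
    · refine Finset.sum_congr rfl fun f hf => ?_
      simp [hne f hf, (hS f hf).1]

/-- A path coordinate is continued constantly to a new leaf. -/
theorem HasPathCoord.extend (h : T.HasPathCoord S a b r)
    (hS : ∀ f ∈ S, T.src f ≠ w ∧ T.tgt f ≠ w) (he : e ∉ S) (ha : a ≠ w) (hb : b ≠ w)
    (hu : u ≠ w) (hew : T.src e = u ∧ T.tgt e = w ∨ T.tgt e = u ∧ T.src e = w) :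
    T.HasPathCoord (insert e S) a b r := by
  obtain ⟨h, σ, hσ⟩ := h
  obtain ⟨h1, h2, h3⟩ := hσ.update (w := w) (e := e) hS he (y := h u) (τ := 0) (by simp) (by
    rcases hew with ⟨h1, h2⟩ | ⟨h1, h2⟩ <;> simp [h1, h2, hu])
  exact ⟨_, _, by simp [ha, hσ.start], by simp [hb, hσ.finish], h1, h2, fun F hF => by
    rw [h3 F hF]; simp⟩

/-- A path is prolonged by a new edge. -/
theorem HasPathCoord.prolong (h : T.HasPathCoord S a u r)
    (hS : ∀ f ∈ S, T.src f ≠ w ∧ T.tgt f ≠ w) (he : e ∉ S) (ha : a ≠ w) (hu : u ≠ w)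
    (hew : T.src e = u ∧ T.tgt e = w ∨ T.tgt e = u ∧ T.src e = w) :
    T.HasPathCoord (insert e S) a w (r + T.len e) := by
  obtain ⟨h, σ, hσ⟩ := h
  have hadd : ∀ F : ℝ → ℝ, Continuous F → (∫ x in r..(r + T.len e), F x) + ∫ x in (0 : ℝ)..r, F x
      = ∫ x in (0 : ℝ)..(r + T.len e), F x := fun F hF => by
    rw [add_comm]
    exact intervalIntegral.integral_add_adjacent_intervals (hF.intervalIntegrable _ _)
      (hF.intervalIntegrable _ _)
  rcases hew with ⟨h1, h2⟩ | ⟨h1, h2⟩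
  · obtain ⟨k1, k2, k3⟩ := hσ.update (w := w) (e := e) hS he (y := r + T.len e) (τ := 1) (by simp)
      (by simp [h1, h2, hu, hσ.finish])
    refine ⟨_, _, by simp [ha, hσ.start], by simp, k1, k2, fun F hF => ?_⟩
    rw [k3 F hF, ← hadd F hF, h1]
    simp [hu, hσ.finish]
  · obtain ⟨k1, k2, k3⟩ := hσ.update (w := w) (e := e) hS he (y := r + T.len e) (τ := -1) (by simp)
      (by simp [h1, h2, hu, hσ.finish])
    refine ⟨_, _, by simp [ha, hσ.start], by simp, k1, k2, fun F hF => ?_⟩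
    rw [k3 F hF, ← hadd F hF, h2]
    have := intervalIntegral.integral_comp_sub_left (a := 0) (b := T.len e) F (r + T.len e)
    rw [sub_zero, add_sub_cancel_right] at this
    rw [← this]
    simp [sub_eq_add_neg]

/-- In a tree, there is a coordinate along a path between any two vertices, and any two points are
joined by a path at most as long as one between vertices which has a coordinate. All three
statements are needed to pass to a tree with one more leaf. -/
theorem IsGrownTree.exists_pathCoord {T : MetricGraph W E} {S : Finset E} {B : Finset W}
    (hT : IsGrownTree T.src T.tgt S B) :
    (∀ a ∈ B, ∀ b ∈ B, ∃ r, T.HasPath (.vertex a) (.vertex b) r ∧ T.HasPathCoord S a b r) ∧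
    (∀ e ∈ S, ∀ x ∈ Set.Icc 0 (T.len e), ∀ b ∈ B, ∃ a ∈ B, ∃ r r', r ≤ r' ∧
      T.HasPath (T.pt e x) (.vertex b) r ∧ T.HasPathCoord S a b r') ∧
    (∀ e ∈ S, ∀ x ∈ Set.Icc 0 (T.len e), ∀ f ∈ S, ∀ y ∈ Set.Icc 0 (T.len f),
      ∃ a ∈ B, ∃ b ∈ B, ∃ r r', r ≤ r' ∧
      T.HasPath (T.pt e x) (T.pt f y) r ∧ T.HasPathCoord S a b r') := by
  induction hT with
  | single w =>
    refine ⟨fun a ha b hb => ?_, by simp, by simp⟩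
    rw [Finset.mem_singleton] at ha hb
    subst ha hb
    exact ⟨0, .refl _, .refl _ _ _⟩
  | @leaf S B e u w hT he hu hw hew ih =>
    obtain ⟨ih1, ih2, ih3⟩ := ih
    have hnw : ∀ a ∈ B, a ≠ w := fun a ha h => hw (h ▸ ha)
    have hS : ∀ f ∈ S, T.src f ≠ w ∧ T.tgt f ≠ w := fun f hf =>
      ⟨hnw _ (hT.ends_mem f hf).1, hnw _ (hT.ends_mem f hf).2⟩
    obtain ⟨c, hc, hcu, hcw⟩ := exists_coord hew
    have hc1 := coord_mem hc
    have hc2 : T.len e - c ∈ Set.Icc 0 (T.len e) :=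
      ⟨sub_nonneg.2 hc1.2, sub_le_self _ hc1.1⟩
    have habs : ∀ x ∈ Set.Icc 0 (T.len e), ∀ y ∈ Set.Icc 0 (T.len e), |y - x| ≤ T.len e :=
      fun x hx y hy => abs_le.2 ⟨by linarith [hx.2, hy.1], by linarith [hx.1, hy.2]⟩
    have ext : ∀ {a b r}, a ∈ B → b ∈ B → T.HasPathCoord S a b r →
        T.HasPathCoord (insert e S) a b r := fun ha hb h =>
      h.extend hS he (hnw _ ha) (hnw _ hb) (hnw u hu) hew
    have pro : ∀ {a r}, a ∈ B → T.HasPathCoord S a u r →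
        T.HasPathCoord (insert e S) a w (r + T.len e) := fun ha h =>
      h.prolong hS he (hnw _ ha) (hnw u hu) hew
    have hB : ∀ {a}, a ∈ B → a ∈ insert w B := Finset.mem_insert_of_mem
    have hwB : w ∈ insert w B := Finset.mem_insert_self w B
    -- the path from a point of the new edge to its old end, and the path along this edge
    have pu : ∀ x ∈ Set.Icc 0 (T.len e), T.HasPath (T.pt e x) (.vertex u) |c - x| := fun x hx => by
      rw [← hcu]; exact .edge hx hc1
    have puw : T.HasPath (.vertex u) (.vertex w) (T.len e) := by
      have := HasPath.edge (G := T) hc1 hc2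
      rw [hcu, hcw] at this
      convert this
      rcases hc with rfl | rfl <;> simp [abs_of_nonneg (T.len_nonneg e)]
    have cuw : T.HasPathCoord (insert e S) u w (T.len e) := by
      simpa using pro hu (.refl T S u)
    refine ⟨?_, ?_, ?_⟩
    · have main : ∀ a ∈ B, ∃ r, T.HasPath (.vertex a) (.vertex w) r ∧
          T.HasPathCoord (insert e S) a w r := fun a ha => by
        obtain ⟨r, h1, h2⟩ := ih1 a ha u hu
        exact ⟨_, h1.trans puw, pro ha h2⟩
      intro a ha b hb
      rcases Finset.mem_insert.1 ha with ha | ha <;> rcases Finset.mem_insert.1 hb with hb | hb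
      · rw [ha, hb]; exact ⟨0, .refl _, .refl _ _ _⟩
      · obtain ⟨r, h1, h2⟩ := main b hb
        rw [ha]; exact ⟨r, h1.symm, h2.symm⟩
      · rw [hb]; exact main a ha
      · obtain ⟨r, h1, h2⟩ := ih1 a ha b hb
        exact ⟨r, h1, ext ha hb h2⟩
    · intro f hf x hx b hb
      rcases Finset.mem_insert.1 hf with rfl | hf <;> rcases Finset.mem_insert.1 hb with rfl | hb
      · refine ⟨u, hB hu, _, _, habs x hx _ hc2, ?_, cuw⟩
        rw [← hcw]; exact .edge hx hc2
      · obtain ⟨r, h1, h2⟩ := ih1 u hu b hb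
        exact ⟨w, hwB, _, r + T.len f, by linarith [habs x hx c hc1], (pu x hx).trans h1,
          (pro hb h2.symm).symm⟩
      · obtain ⟨a, ha, r, r', hr, h1, h2⟩ := ih2 f hf x hx u hu
        exact ⟨a, hB ha, _, r' + T.len e, by linarith, h1.trans puw, pro ha h2⟩
      · obtain ⟨a, ha, r, r', hr, h1, h2⟩ := ih2 f hf x hx b hb
        exact ⟨a, hB ha, r, r', hr, h1, ext ha hb h2⟩
    · have main : ∀ f ∈ S, ∀ x ∈ Set.Icc 0 (T.len f), ∀ y ∈ Set.Icc 0 (T.len e),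
          ∃ a ∈ insert w B, ∃ b ∈ insert w B, ∃ r r', r ≤ r' ∧
          T.HasPath (T.pt f x) (T.pt e y) r ∧ T.HasPathCoord (insert e S) a b r' := by
        intro f hf x hx y hy
        obtain ⟨a, ha, r, r', hr, h1, h2⟩ := ih2 f hf x hx u hu
        exact ⟨a, hB ha, w, hwB, _, r' + T.len e, by linarith [habs y hy c hc1],
          h1.trans (pu y hy).symm, pro ha h2⟩
      intro f hf x hx g hg y hy
      rcases Finset.mem_insert.1 hf with rfl | hf <;> rcases Finset.mem_insert.1 hg with rfl | hg
      · exact ⟨u, hB hu, w, hwB, _, _, habs x hx y hy, .edge hx hy, cuw⟩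
      · obtain ⟨a, ha, b, hb, r, r', hr, h1, h2⟩ := main g hg y hy x hx
        exact ⟨a, ha, b, hb, r, r', hr, h1.symm, h2⟩
      · exact main f ‹f ∈ S› x hx y hy
      · obtain ⟨a, ha, b, hb, r, r', hr, h1, h2⟩ := ih3 f hf x hx g hg y hy
        exact ⟨a, hB ha, b, hB hb, r, r', hr, h1, ext ha hb h2⟩

/-! ### Cutting a graph open to a tree -/

/-- The graph obtained by cutting each edge `e` in `C` off its second end, which becomes a new
vertex `inr e`. -/
def cut (G : MetricGraph V E) (C : Finset E) : MetricGraph (V ⊕ E) E where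
  src e := .inl (G.src e)
  tgt e := if e ∈ C then .inr e else .inl (G.tgt e)
  len := G.len
  len_pos := G.len_pos

/-- Undoing the cuts. -/
def uncut (G : MetricGraph V E) (C : Finset E) : (G.cut C).Space → G.Space
  | .vertex (.inl v) => .vertex v
  | .vertex (.inr e) => .vertex (G.tgt e)
  | .interior e x hx => .interior e x hx

theorem uncut_pt (G : MetricGraph V E) (C : Finset E) (e : E) (x : ℝ) :
    G.uncut C ((G.cut C).pt e x) = G.pt e x := by
  unfold pt
  by_cases h0 : x ≤ 0
  · simp [h0, cut, uncut]
  by_cases h1 : G.len e ≤ x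
  · by_cases he : e ∈ C <;> simp [h0, h1, cut, uncut, he]
  · simp [h0, h1, cut, uncut]

theorem HasPath.uncut {C : Finset E} {p q : (G.cut C).Space} {r : ℝ}
    (h : (G.cut C).HasPath p q r) : G.HasPath (G.uncut C p) (G.uncut C q) r := by
  induction h with
  | refl => exact .refl _
  | step e s t r hs ht h ih =>
    rw [uncut_pt] at ih ⊢
    exact .step _ e s t r hs ht ih

/-- A connected graph is cut open to a tree by as many cuts as its first Betti number. -/
theorem Connected.exists_cut [Fintype V] [Fintype E] [DecidableEq V] (hG : G.Connected) :
    ∃ (C : Finset E) (B : Finset (V ⊕ E)), Fintype.card V + C.card = Fintype.card E + 1 ∧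
      IsGrownTree (G.cut C).src (G.cut C).tgt Finset.univ B := by
  obtain ⟨v₀⟩ := hG.1
  have := hG.edge_induction (fun S A => ∃ (C : Finset E) (B : Finset (V ⊕ E)), C ⊆ S ∧
    A.card + C.card = S.card + 1 ∧ (∀ v, .inl v ∈ B ↔ v ∈ A) ∧ (∀ e, .inr e ∈ B → e ∈ S) ∧
    IsGrownTree (G.cut C).src (G.cut C).tgt S B) v₀
    ⟨∅, {.inl v₀}, by simp, by simp, by simp, by simp, .single _⟩ ?_
  · obtain ⟨C, B, -, hcard, -, -, hT⟩ := this
    exact ⟨C, B, hcard, hT⟩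
  rintro S A e v w he hv hvw ⟨C, B, hCS, hcard, hB, hB', hT⟩
  by_cases hw : w ∈ A
  · -- the edge closes a cycle and is cut
    refine ⟨insert e C, insert (.inr e) B, Finset.insert_subset_insert e hCS, ?_, ?_, ?_, ?_⟩
    · rw [Finset.insert_eq_of_mem hw, Finset.card_insert_of_notMem he,
        Finset.card_insert_of_notMem fun h => he (hCS h)]
      omega
    · simpa [hw] using hB
    · intro f hf
      rcases Finset.mem_insert.1 hf with hf | hf
      · simp [Sum.inr_injective hf]
      · exact Finset.mem_insert_of_mem (hB' f hf)
    · refine .leaf e (.inl (G.src e)) _ (hT.congr (fun f _ => rfl) fun f hf => ?_) he ?_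
        (fun h => he (hB' e h)) (.inl ⟨rfl, by simp [cut]⟩)
      · have : f ≠ e := fun h => he (h ▸ hf)
        simp [cut, this]
      · rw [hB]
        rcases hvw with ⟨rfl, rfl⟩ | ⟨rfl, rfl⟩ <;> assumption
  · refine ⟨C, insert (.inl w) B, hCS.trans (Finset.subset_insert e S), ?_, ?_, ?_, ?_⟩
    · rw [Finset.card_insert_of_notMem hw, Finset.card_insert_of_notMem he]
      omega
    · intro x
      simp [hB]
    · intro f hf
      exact Finset.mem_insert_of_mem (hB' f (by simpa using hf))
    · refine .leaf e (.inl v) _ hT he ((hB v).2 hv) (fun h => hw ((hB w).1 h)) ?_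
      have heC : e ∉ C := fun h => he (hCS h)
      rcases hvw with ⟨rfl, rfl⟩ | ⟨rfl, rfl⟩ <;> simp [cut, heC]

end Tree

/-! ### Trigonometric test functions along a path -/

theorem integral_sum_sq_of_orthogonal {ι : Type*} [Fintype ι] {ψ : ι → ℝ → ℝ} {r : ℝ}
    (hψ : ∀ k, Continuous (ψ k)) (horth : ∀ j k, j ≠ k → ∫ x in (0 : ℝ)..r, ψ j x * ψ k x = 0)
    (c : ι → ℝ) :
    ∫ x in (0 : ℝ)..r, (∑ k, c k * ψ k x) ^ 2 = ∑ k, c k ^ 2 * ∫ x in (0 : ℝ)..r, ψ k x ^ 2 := by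
  classical
  have h1 : ∀ x, (∑ k, c k * ψ k x) ^ 2 = ∑ j, ∑ k, c j * c k * (ψ j x * ψ k x) := fun x => by
    rw [sq, Finset.sum_mul_sum]
    exact Finset.sum_congr rfl fun j _ => Finset.sum_congr rfl fun k _ => by ring
  have hc : ∀ j k, Continuous fun x => c j * c k * (ψ j x * ψ k x) := fun j k =>
    continuous_const.mul ((hψ j).mul (hψ k))
  simp_rw [h1]
  rw [intervalIntegral.integral_finsetSum fun j _ =>
    (continuous_finsetSum _ fun k _ => hc j k).intervalIntegrable _ _]
  refine Finset.sum_congr rfl fun j _ => ?_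
  rw [intervalIntegral.integral_finsetSum fun k _ => (hc j k).intervalIntegrable _ _,
    Finset.sum_eq_single j]
  · rw [intervalIntegral.integral_const_mul]
    simp_rw [sq]
  · intro k _ hk
    rw [intervalIntegral.integral_const_mul, horth j k hk.symm, mul_zero]
  · simp

/-- The cosine polynomial with coefficients `c` and the frequencies `k π / r`. -/
noncomputable def cosPoly (r : ℝ) {n : ℕ} (c : Fin n → ℝ) (x : ℝ) : ℝ :=
  ∑ k, c k * Real.cos ((k : ℤ) * Real.pi / r * x)

/-- The derivative of `cosPoly r c`. -/
noncomputable def cosPolyDeriv (r : ℝ) {n : ℕ} (c : Fin n → ℝ) (x : ℝ) : ℝ :=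
  ∑ k, (-c k * ((k : ℤ) * Real.pi / r)) * Real.sin ((k : ℤ) * Real.pi / r * x)

section cosPoly

variable {r : ℝ} {n : ℕ}

theorem hasDerivAt_cosPoly (c : Fin n → ℝ) (x : ℝ) :
    HasDerivAt (cosPoly r c) (cosPolyDeriv r c x) x := by
  refine HasDerivAt.fun_sum fun k _ => ?_
  have := (((hasDerivAt_id x).const_mul ((k : ℤ) * Real.pi / r)).cos).const_mul (c k)
  exact this.congr_deriv (by simp; ring)

theorem continuous_cosPoly (c : Fin n → ℝ) : Continuous (cosPoly r c) := by
  unfold cosPoly; fun_prop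

theorem continuous_cosPolyDeriv (c : Fin n → ℝ) : Continuous (cosPolyDeriv r c) := by
  unfold cosPolyDeriv; fun_prop

theorem integral_cosPoly_sq (hr : 0 < r) (c : Fin n → ℝ) :
    ∫ x in (0 : ℝ)..r, cosPoly r c x ^ 2
      = ∑ k, c k ^ 2 * ((r + if (k : ℕ) = 0 then r else 0) / 2) := by
  unfold cosPoly
  rw [integral_sum_sq_of_orthogonal (fun k => by fun_prop)]
  · refine Finset.sum_congr rfl fun k _ => ?_
    simp_rw [sq (Real.cos _)]
    rw [integral_cos_mul_cos hr]
    simp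
  · intro j k hjk
    have h : (j : ℕ) ≠ k := fun h => hjk (Fin.ext h)
    rw [integral_cos_mul_cos hr, if_neg (by omega), if_neg (by omega)]
    simp

theorem integral_cosPolyDeriv_sq (hr : 0 < r) (c : Fin n → ℝ) :
    ∫ x in (0 : ℝ)..r, cosPolyDeriv r c x ^ 2
      = ∑ k, (-c k * ((k : ℤ) * Real.pi / r)) ^ 2 *
          ((r - if (k : ℕ) = 0 then r else 0) / 2) := by
  unfold cosPolyDeriv
  rw [integral_sum_sq_of_orthogonal (fun k => by fun_prop)]
  · refine Finset.sum_congr rfl fun k _ => ?_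
    simp_rw [sq (Real.sin _)]
    rw [integral_sin_mul_sin hr]
    simp
  · intro j k hjk
    have h : (j : ℕ) ≠ k := fun h => hjk (Fin.ext h)
    rw [integral_sin_mul_sin hr, if_neg (by omega), if_neg (by omega)]
    simp

theorem integral_cosPoly_sq_pos (hr : 0 < r) {c : Fin n → ℝ} (hc : c ≠ 0) :
    0 < ∫ x in (0 : ℝ)..r, cosPoly r c x ^ 2 := by
  rw [integral_cosPoly_sq hr]
  obtain ⟨k, hk⟩ := Function.ne_iff.1 hc
  have h : ∀ k : Fin n, 0 < (r + if (k : ℕ) = 0 then r else 0) / 2 := fun k => by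
    split_ifs <;> positivity
  exact Finset.sum_pos' (fun k _ => mul_nonneg (sq_nonneg _) (h k).le)
    ⟨k, Finset.mem_univ k, mul_pos (by have : c k ≠ 0 := hk; positivity) (h k)⟩

theorem integral_cosPolyDeriv_sq_le (hr : 0 < r) (c : Fin (n + 1) → ℝ) :
    ∫ x in (0 : ℝ)..r, cosPolyDeriv r c x ^ 2
      ≤ (n * Real.pi / r) ^ 2 * ∫ x in (0 : ℝ)..r, cosPoly r c x ^ 2 := by
  rw [integral_cosPoly_sq hr, integral_cosPolyDeriv_sq hr, Finset.mul_sum]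
  refine Finset.sum_le_sum fun k _ => ?_
  have hpi := Real.pi_pos
  have hk : ((k : ℕ) : ℝ) ≤ n := by exact_mod_cast Nat.lt_succ_iff.1 k.2
  have h1 : ((k : ℤ) * Real.pi / r) ^ 2 ≤ (n * Real.pi / r) ^ 2 := by
    push_cast
    gcongr
  have h0 : 0 ≤ (if (k : ℕ) = 0 then r else 0) := by split_ifs <;> positivity
  have h2 : 0 ≤ (r + if (k : ℕ) = 0 then r else 0) / 2 := by linarith
  calc _ = c k ^ 2 * ((k : ℤ) * Real.pi / r) ^ 2 *
          ((r - if (k : ℕ) = 0 then r else 0) / 2) := by ring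
    _ ≤ c k ^ 2 * (n * Real.pi / r) ^ 2 * ((r + if (k : ℕ) = 0 then r else 0) / 2) := by
        have h3 : (r - if (k : ℕ) = 0 then r else 0) / 2
            ≤ (r + if (k : ℕ) = 0 then r else 0) / 2 := by linarith
        refine (mul_le_mul_of_nonneg_left h3 (by positivity)).trans ?_
        gcongr
    _ = _ := by ring

end cosPoly

/-- The functions `cosPoly` of the path coordinate with `|C| + 2` coefficients form a space
large enough to satisfy `|C|` gluing conditions and the condition of mean value zero. -/
theorem spectralGap_le_of_pathCoord [Fintype E] [Nonempty E] [DecidableEq E] {C : Finset E}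
    {a b : V ⊕ E} {r : ℝ} (hr : 0 < r) (h : (G.cut C).HasPathCoord Finset.univ a b r) :
    G.spectralGap ≤ ((C.card + 1 : ℕ) * Real.pi / r) ^ 2 := by
  obtain ⟨h, σ, hσ⟩ := h
  set n := C.card + 1 with hn
  let ψ : Fin (n + 1) → ℝ → ℝ := fun k x => Real.cos ((k : ℤ) * Real.pi / r * x)
  have hψc : ∀ k, Continuous (ψ k) := fun k => by fun_prop
  let y : E → ℝ → ℝ := fun e x => h (.inl (G.src e)) + σ e * x
  have hy : ∀ e, Continuous (y e) := fun e => by fun_prop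
  let Λ : (Fin (n + 1) → ℝ) →ₗ[ℝ] (Option C → ℝ) := Matrix.toLin' (Matrix.of fun i k =>
    match i with
    | none => ∑ e, ∫ x in (0 : ℝ)..(G.len e), ψ k (y e x)
    | some e => ψ k (h (.inr e)) - ψ k (h (.inl (G.tgt e))))
  obtain ⟨c, hc, hc0⟩ : ∃ c, Λ c = 0 ∧ c ≠ 0 := by
    have : LinearMap.ker Λ ≠ ⊥ := LinearMap.ker_ne_bot_of_finrank_lt (by simp [hn])
    obtain ⟨c, hc, hc0⟩ := Submodule.exists_mem_ne_zero_of_ne_bot this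
    exact ⟨c, hc, hc0⟩
  have hglue : ∀ e ∈ C, cosPoly r c (h (.inr e)) = cosPoly r c (h (.inl (G.tgt e))) := by
    intro e he
    have h1 := congrFun hc (some ⟨e, he⟩)
    simp only [Λ, Matrix.toLin'_apply, Matrix.mulVec, dotProduct, Matrix.of_apply, Pi.zero_apply,
      sub_mul, Finset.sum_sub_distrib] at h1
    simp only [cosPoly, mul_comm (c _)]
    exact sub_eq_zero.1 h1
  have hmean : ∑ e, ∫ x in (0 : ℝ)..(G.len e), cosPoly r c (y e x) = 0 := by
    have h1 := congrFun hc none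
    simp only [Λ, Matrix.toLin'_apply, Matrix.mulVec, dotProduct, Matrix.of_apply, Pi.zero_apply,
      Finset.sum_mul] at h1
    rw [Finset.sum_comm] at h1
    refine Eq.trans (Finset.sum_congr rfl fun e _ => ?_) h1
    have hi : ∀ k, Continuous fun x => c k * ψ k (y e x) := fun k =>
      continuous_const.mul ((hψc k).comp (hy e))
    change ∫ x in (0 : ℝ)..(G.len e), ∑ k, c k * ψ k (y e x) = _
    rw [intervalIntegral.integral_finsetSum fun k _ => (hi k).intervalIntegrable _ _]
    refine Finset.sum_congr rfl fun k _ => ?_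
    rw [intervalIntegral.integral_const_mul, mul_comm]
  have hd : ∀ e x, HasDerivAt (fun x => cosPoly r c (y e x))
      (cosPolyDeriv r c (y e x) * σ e) x := fun e x => by
    have h1 : HasDerivAt (y e) (σ e) x :=
      (((hasDerivAt_id x).const_mul (σ e)).const_add (h (.inl (G.src e)))).congr_deriv (mul_one _)
    exact (hasDerivAt_cosPoly c (y e x)).comp x h1
  have hcP := continuous_cosPoly (r := r) c
  have hcD := continuous_cosPolyDeriv (r := r) c
  have hS2 : ∫ x in (0 : ℝ)..r, cosPoly r c x ^ 2
      ≤ ∑ e, ∫ x in (0 : ℝ)..(G.len e), cosPoly r c (y e x) ^ 2 := by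
    rw [← hσ.tile (fun x => cosPoly r c x ^ 2) (hcP.pow 2)]
    refine Finset.sum_le_sum fun e he => mul_le_of_le_one_left
      (integral_sq_nonneg (fun x => cosPoly r c (y e x)) e) ?_
    rcases hσ.slope e he with h | h | h <;> norm_num [h]
  have hD : ∑ e, ∫ x in (0 : ℝ)..(G.len e), (cosPolyDeriv r c (y e x) * σ e) ^ 2
      = ∫ x in (0 : ℝ)..r, cosPolyDeriv r c x ^ 2 := by
    rw [← hσ.tile (fun x => cosPolyDeriv r c x ^ 2) (hcD.pow 2)]
    refine Finset.sum_congr rfl fun e _ => ?_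
    simp_rw [mul_pow]
    rw [intervalIntegral.integral_mul_const, mul_comm]
    rfl
  have hpos := integral_cosPoly_sq_pos hr hc0
  refine spectralGap_le_of_test (a := fun v => cosPoly r c (h (.inl v)))
    (f := fun e x => cosPoly r c (y e x)) hd (fun e => (hcD.comp (hy e)).mul continuous_const)
    (fun e => by simp [y]) (fun e => ?_) ?_ ?_
  · have h1 := hσ.affine e (Finset.mem_univ e)
    change cosPoly r c (h (.inl (G.src e)) + σ e * G.len e) = _
    have h2 : h ((G.cut C).src e) + σ e * (G.cut C).len e
      = h (.inl (G.src e)) + σ e * G.len e := rfl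
    rw [← h2, ← h1]
    by_cases he : e ∈ C
    · simp [cut, he, hglue e he]
    · simp [cut, he]
  · rw [hmean]
    simp only [ne_eq, OfNat.ofNat_ne_zero, not_false_eq_true, zero_pow, zero_div, sub_zero]
    linarith
  · rw [hmean, hD]
    simp only [ne_eq, OfNat.ofNat_ne_zero, not_false_eq_true, zero_pow, zero_div, sub_zero]
    exact (integral_cosPolyDeriv_sq_le hr c).trans (by gcongr)

theorem spectralGap_mul_meanDist_sq_le_betti [Fintype V] [Fintype E] [Nonempty E]
    (hG : G.Connected) :
    G.spectralGap * G.meanDist ^ 2 ≤ Real.pi ^ 2 * (1 + (G.betti : ℝ)) ^ 2 := by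
  classical
  have hμ := G.spectralGap_nonneg
  have hpi := Real.pi_pos
  obtain ⟨C, B, hcard, hT⟩ := hG.exists_cut
  have hβ : (1 + (G.betti : ℝ)) = (C.card + 1 : ℕ) := by
    have : ((Fintype.card V : ℝ) + C.card) = Fintype.card E + 1 := by exact_mod_cast hcard
    simp only [betti]
    push_cast
    linarith
  rw [hβ]
  set n := C.card + 1 with hn
  have hnpos : (0 : ℝ) < n := by positivity
  rcases hμ.eq_or_lt with h0 | hpos
  · rw [← h0, zero_mul]; positivity
  set m := Real.sqrt G.spectralGap with hm
  have hmpos : 0 < m := Real.sqrt_pos.2 hpos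
  have hm2 : m ^ 2 = G.spectralGap := Real.sq_sqrt hμ
  have hρ : G.meanDist ≤ n * Real.pi / m := by
    refine hG.meanDist_le_of_forall_dist_le fun e s hs f t ht => ?_
    obtain ⟨a, -, b, -, r, r', hr, h1, h2⟩ := hT.exists_pathCoord.2.2 e (Finset.mem_univ e) s hs
      f (Finset.mem_univ f) t ht
    have h3 := dist_le_of_hasPath h1.uncut
    rw [uncut_pt, uncut_pt] at h3
    refine (h3.trans hr).trans ?_
    rcases le_or_gt r' 0 with h0 | hr'
    · exact h0.trans (by positivity)
    · have h4 := spectralGap_le_of_pathCoord hr' h2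
      rw [← hm2, sq_le_sq₀ hmpos.le (by positivity)] at h4
      rwa [le_div_iff₀ hr', mul_comm, ← le_div_iff₀ hmpos] at h4
  have hρ0 := (meanDist_pos hG).le
  calc _ ≤ m ^ 2 * (n * Real.pi / m) ^ 2 := by rw [hm2]; gcongr
    _ = _ := by field_simp

/-! ### Weak derivatives on an interval -/

/-- The du Bois-Reymond lemma for continuous functions on an interval. -/
theorem exists_eq_const_of_integral_mul_deriv_eq_zero {h : ℝ → ℝ} {l : ℝ} (hl : 0 < l)
    (hc : ContinuousOn h (Set.Icc 0 l))
    (H : ∀ φ : ℝ → ℝ, ContDiff ℝ ∞ φ → HasCompactSupport φ → tsupport φ ⊆ Set.Ioo 0 l →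
      ∫ x in (0 : ℝ)..l, h x * deriv φ x = 0) :
    ∃ c, ∀ x ∈ Set.Icc 0 l, h x = c := by
  let f : ContDiffBump (l / 2 : ℝ) := ⟨l / 8, l / 4, by linarith, by linarith⟩
  set ρ := f.normed volume with hρ
  have hρc : ContDiff ℝ ∞ ρ := f.contDiff_normed
  have hρs : tsupport ρ = Set.Icc (l / 4) (3 * l / 4) := by
    rw [hρ, f.tsupport_normed_eq, Real.closedBall_eq_Icc]
    congr 1 <;> simp only [f] <;> ring
  have hρi : ∫ x in (0 : ℝ)..l, ρ x = 1 := by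
    rw [intervalIntegral.integral_eq_integral_of_support_subset, f.integral_normed]
    refine (subset_tsupport ρ).trans ?_
    rw [hρs]
    intro x hx
    exact ⟨by linarith [hx.1], by linarith [hx.2]⟩
  set c := ∫ x in (0 : ℝ)..l, h x * ρ x with hcdef
  have hint : ∀ ψ : ℝ → ℝ, Continuous ψ → IntervalIntegrable (fun x => h x * ψ x) volume 0 l :=
    fun ψ hψ => ContinuousOn.intervalIntegrable (by
      rw [Set.uIcc_of_le hl.le]; exact hc.mul hψ.continuousOn)
  have key : ∀ ψ : ℝ → ℝ, ContDiff ℝ ∞ ψ → HasCompactSupport ψ → tsupport ψ ⊆ Set.Ioo 0 l →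
      ∫ x, ψ x • (h x - c) = 0 := by
    intro ψ hψ hψc hψs
    set m := ∫ x in (0 : ℝ)..l, ψ x with hm
    -- subtracting a multiple of the bump function gives the derivative of a test function
    let χ : ℝ → ℝ := fun x => ψ x - m * ρ x
    have hχ : ContDiff ℝ ∞ χ := hψ.sub (contDiff_const.mul hρc)
    let Φ : ℝ → ℝ := fun x => ∫ t in (0 : ℝ)..x, χ t
    have hΦd : ∀ x, HasDerivAt Φ (χ x) x := fun x =>
      intervalIntegral.integral_hasDerivAt_right (hχ.continuous.intervalIntegrable _ _)
        (hχ.continuous.stronglyMeasurableAtFilter _ _) hχ.continuous.continuousAt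
    have hΦ' : deriv Φ = χ := funext fun x => (hΦd x).deriv
    have hΦ : ContDiff ℝ ∞ Φ :=
      contDiff_infty_iff_deriv.2 ⟨fun x => (hΦd x).differentiableAt, by rwa [hΦ']⟩
    obtain ⟨a, b, ha, hb, hab⟩ : ∃ a b, 0 < a ∧ b < l ∧ tsupport ψ ∪ tsupport ρ ⊆ Set.Icc a b := by
      have hK : IsCompact (tsupport ψ ∪ tsupport ρ) := by
        rw [hρs]; exact IsCompact.union hψc isCompact_Icc
      have hKs : tsupport ψ ∪ tsupport ρ ⊆ Set.Ioo 0 l := by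
        rw [hρs]
        exact Set.union_subset hψs fun x hx => ⟨by linarith [hx.1], by linarith [hx.2]⟩
      have hne : (tsupport ψ ∪ tsupport ρ).Nonempty := by
        rw [hρs]
        exact ⟨l / 2, .inr ⟨by linarith, by linarith⟩⟩
      obtain ⟨a, ha⟩ := hK.exists_isLeast hne
      obtain ⟨b, hb⟩ := hK.exists_isGreatest hne
      exact ⟨a, b, (hKs ha.1).1, (hKs hb.1).2, fun x hx => ⟨ha.2 hx, hb.2 hx⟩⟩
    have hχ0 : ∀ x, x ∉ Set.Icc a b → χ x = 0 := fun x hx => by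
      have h1 : ψ x = 0 := image_eq_zero_of_notMem_tsupport fun h => hx (hab (.inl h))
      have h2 : ρ x = 0 := image_eq_zero_of_notMem_tsupport fun h => hx (hab (.inr h))
      simp [χ, h1, h2]
    have hχi : ∫ t in (0 : ℝ)..l, χ t = 0 := by
      have hmρ : IntervalIntegrable (fun x => m * ρ x) volume 0 l :=
        (hρc.continuous.intervalIntegrable _ _).const_mul m
      simp only [χ]
      rw [intervalIntegral.integral_sub (hψ.continuous.intervalIntegrable _ _) hmρ,
        intervalIntegral.integral_const_mul, hρi, ← hm]
      ring
    have hzero : ∀ p q, (∀ t ∈ Set.uIoc p q, t ∉ Set.Icc a b) → ∫ t in p..q, χ t = 0 :=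
      fun p q h => by
        rw [intervalIntegral.integral_congr_ae (g := fun _ => 0)
          (Filter.Eventually.of_forall fun t ht => hχ0 t (h t ht))]
        simp
    have hΦ0 : ∀ x, x ∉ Set.Icc a b → Φ x = 0 := by
      intro x hx
      rcases lt_or_ge x a with h | h
      · refine hzero _ _ fun t ht ht' => ?_
        rcases Set.mem_uIoc.1 ht with h1 | h1 <;> linarith [ht'.1, h1.2]
      · have hbx : b < x := by
          by_contra! hcon
          exact hx ⟨h, hcon⟩
        have := intervalIntegral.integral_add_adjacent_intervals (a := 0) (b := x) (c := l)
          (hχ.continuous.intervalIntegrable (μ := volume) _ _)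
          (hχ.continuous.intervalIntegrable _ _)
        rw [hχi, hzero x l fun t ht ht' => ?_, add_zero] at this
        · exact this
        · rcases Set.mem_uIoc.1 ht with h1 | h1 <;> linarith [ht'.2, h1.1]
    have hsupp : Function.support Φ ⊆ Set.Icc a b := fun x hx => by
      by_contra h
      exact hx (hΦ0 x h)
    have h0 := H Φ hΦ (HasCompactSupport.intro isCompact_Icc hΦ0)
      ((closure_minimal hsupp isClosed_Icc).trans fun x hx => ⟨ha.trans_le hx.1, hx.2.trans_lt hb⟩)
    rw [hΦ'] at h0
    have h1 : ∫ x in (0 : ℝ)..l, h x * χ x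
        = (∫ x in (0 : ℝ)..l, h x * ψ x) - m * c := by
      rw [hcdef, ← intervalIntegral.integral_const_mul,
        ← intervalIntegral.integral_sub (hint _ hψ.continuous)
          ((hint _ hρc.continuous).const_mul m)]
      congr 1 with x
      simp only [χ]
      ring
    have h2 : ∫ x in (0 : ℝ)..l, ψ x * (h x - c)
        = (∫ x in (0 : ℝ)..l, h x * ψ x) - m * c := by
      have hψi : IntervalIntegrable (fun x => ψ x * c) volume 0 l :=
        (hψ.continuous.intervalIntegrable _ _).mul_const c
      rw [hm, ← intervalIntegral.integral_mul_const,
        ← intervalIntegral.integral_sub (hint _ hψ.continuous) hψi]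
      congr 1 with x
      ring
    rw [← intervalIntegral.integral_eq_integral_of_support_subset (a := 0) (b := l)]
    · simp only [smul_eq_mul]
      rw [h2, ← h1, h0]
    · intro x hx
      refine Set.Ioo_subset_Ioc_self (hψs (subset_tsupport ψ fun h => hx ?_))
      simp [h]
  refine ⟨c, ?_⟩
  have hsub : ContinuousOn (fun x => h x - c) (Set.Icc 0 l) := hc.sub continuousOn_const
  have hae := isOpen_Ioo.ae_eq_zero_of_integral_contDiff_smul_eq_zero
    ((hsub.mono Set.Ioo_subset_Icc_self).locallyIntegrableOn measurableSet_Ioo) key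
  refine Measure.eqOn_Icc_of_ae_eq volume hl.ne ?_ hc continuousOn_const
  rw [← Measure.restrict_congr_set Ioo_ae_eq_Icc]
  filter_upwards [(ae_restrict_iff' measurableSet_Ioo).2 hae] with x hx
  linarith

/-- On `[0, T]`, the function `w` is a primitive of the square integrable function `γ`. -/
structure IsPrimitive (T : ℝ) (w γ : ℝ → ℝ) : Prop where
  nonneg : 0 ≤ T
  integrable : IntervalIntegrable γ volume 0 T
  integrable_sq : IntervalIntegrable (fun x => γ x ^ 2) volume 0 T
  eq_integral : ∀ x ∈ Set.Icc 0 T, w x = w 0 + ∫ t in (0 : ℝ)..x, γ t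

theorem absolutelyContinuous_primitive {γ : ℝ → ℝ} {T : ℝ}
    (h : IntervalIntegrable γ volume 0 T) (w₀ : ℝ) :
    AbsolutelyContinuousOnInterval (fun x => w₀ + ∫ t in (0 : ℝ)..x, γ t) 0 T := by
  have h1 := h.absolutelyContinuousOnInterval_intervalIntegral (c := 0) (by simp)
  have h2 : AbsolutelyContinuousOnInterval (fun _ : ℝ => w₀) 0 T :=
    contDiff_const.contDiffOn.absolutelyContinuousOnInterval
  exact h2.add h1

theorem IsPrimitive.continuousOn {T : ℝ} {w γ : ℝ → ℝ} (h : IsPrimitive T w γ) :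
    ContinuousOn w (Set.uIcc 0 T) := by
  refine (absolutelyContinuous_primitive h.integrable (w 0)).continuousOn.congr fun x hx => ?_
  rw [Set.uIcc_of_le h.nonneg] at hx
  exact h.eq_integral x hx

/-- Integration by parts for a primitive and a smooth function. -/
theorem IsPrimitive.integral_mul_deriv {T : ℝ} {w γ φ φ' : ℝ → ℝ} (h : IsPrimitive T w γ)
    (hφ : ∀ x, HasDerivAt φ (φ' x) x) (hφ' : Continuous φ') :
    ∫ x in (0 : ℝ)..T, w x * φ' x = w T * φ T - w 0 * φ 0 - ∫ x in (0 : ℝ)..T, γ x * φ x := by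
  have hd : deriv φ = φ' := funext fun x => (hφ x).deriv
  have hC : ContDiff ℝ 1 φ :=
    contDiff_one_iff_deriv.2 ⟨fun x => (hφ x).differentiableAt, by rwa [hd]⟩
  have h1 := (absolutelyContinuous_primitive h.integrable (w 0)).integral_mul_deriv_eq_deriv_mul
    hC.contDiffOn.absolutelyContinuousOnInterval
  rw [hd] at h1
  rw [intervalIntegral.integral_congr (g := fun x => (w 0 + ∫ t in (0 : ℝ)..x, γ t) * φ' x)
    fun x hx => ?_, h1, ← h.eq_integral T ⟨h.nonneg, le_rfl⟩]
  · rw [intervalIntegral.integral_same, add_zero]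
    congr 1
    refine intervalIntegral.integral_congr_ae ?_
    filter_upwards [h.integrable.ae_hasDerivAt_integral] with x hx hx'
    rw [((hx (Set.uIoc_subset_uIcc hx') 0 (by simp)).const_add (w 0)).deriv]
  · rw [Set.uIcc_of_le h.nonneg] at hx
    exact congrArg (· * φ' x) (h.eq_integral x hx)

/-- On each edge, a function in `H¹` is a primitive of its weak derivative. -/
theorem IsH1.isPrimitive {u : G.Space → ℝ} {g : E → ℝ → ℝ} (h : G.IsH1 u g) (e : E) :
    IsPrimitive (G.len e) (fun x => u (G.pt e x)) (g e) := by
  have hl := G.len_pos e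
  have hL2 := h.memLp e
  rw [Measure.restrict_congr_set Ioo_ae_eq_Ioc] at hL2
  have hi : IntervalIntegrable (g e) volume 0 (G.len e) := by
    rw [intervalIntegrable_iff_integrableOn_Ioc_of_le hl.le]
    exact hL2.integrable one_le_two
  have hi2 : IntervalIntegrable (fun x => g e x ^ 2) volume 0 (G.len e) := by
    rw [intervalIntegrable_iff_integrableOn_Ioc_of_le hl.le]
    exact hL2.integrable_sq
  have hP : IsPrimitive (G.len e) (fun x => ∫ t in (0 : ℝ)..x, g e t) (g e) :=
    ⟨hl.le, hi, hi2, fun x _ => by simp⟩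
  have hPc : ContinuousOn (fun x => ∫ t in (0 : ℝ)..x, g e t) (Set.Icc 0 (G.len e)) := by
    rw [← Set.uIcc_of_le hl.le]
    exact intervalIntegral.continuousOn_primitive_interval' hi (by simp)
  obtain ⟨c, hc⟩ := exists_eq_const_of_integral_mul_deriv_eq_zero
    (h := fun x => u (G.pt e x) - ∫ t in (0 : ℝ)..x, g e t) hl
    ((h.continuousOn e).sub hPc) fun φ hφ hφc hφs => by
      have hz : ∀ x, x ∉ Set.Ioo 0 (G.len e) → φ x = 0 := fun x hx =>
        image_eq_zero_of_notMem_tsupport fun h => hx (hφs h)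
      have hφ' : Continuous (deriv φ) := hφ.continuous_deriv (by simp)
      have h1 := h.weakDeriv e φ hφ hφc hφs
      have h2 := hP.integral_mul_deriv (φ := φ) (φ' := deriv φ)
        (fun x => (hφ.differentiable (by simp) x).hasDerivAt) hφ'
      rw [hz 0 (by simp), hz (G.len e) (by simp)] at h2
      have hi1 := (intervalIntegrable_of_continuousOn (h.continuousOn e)).mul_continuousOn
        hφ'.continuousOn
      have hi2 := (intervalIntegrable_of_continuousOn hPc).mul_continuousOn hφ'.continuousOn
      simp only [sub_mul]
      rw [intervalIntegral.integral_sub hi1 hi2, h1, h2]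
      ring
  refine ⟨hl.le, hi, hi2, fun x hx => ?_⟩
  have h1 := hc x hx
  have h2 := hc 0 (G.zero_mem e)
  simp only [intervalIntegral.integral_same, sub_zero] at h1 h2
  rw [h2, ← h1]
  ring

/-! ### Wirtinger's inequality -/

theorem norm_sq_fourierCoeffOn {T : ℝ} (hT : 0 < T) {f : ℝ → ℝ}
    (hf : IntervalIntegrable f volume 0 T) (n : ℤ) :
    ‖fourierCoeffOn hT (fun x => (f x : ℂ)) n‖ ^ 2
      = (1 / T) ^ 2 * ((∫ x in (0 : ℝ)..T, f x * Real.cos (2 * Real.pi * n / T * x)) ^ 2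
        + (∫ x in (0 : ℝ)..T, f x * Real.sin (2 * Real.pi * n / T * x)) ^ 2) := by
  have hT' : Fact (0 < T - 0) := ⟨by linarith⟩
  have hc := hf.mul_continuousOn (g := fun x => Real.cos (2 * Real.pi * n / T * x))
    (Continuous.continuousOn (by fun_prop))
  have hs := hf.mul_continuousOn (g := fun x => Real.sin (2 * Real.pi * n / T * x))
    (Continuous.continuousOn (by fun_prop))
  rw [fourierCoeffOn_eq_integral]
  have h1 : ∀ x : ℝ, fourier (-n) (x : AddCircle (T - 0)) • (f x : ℂ)
      = ((f x * Real.cos (2 * Real.pi * n / T * x) : ℝ) : ℂ)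
        - ((f x * Real.sin (2 * Real.pi * n / T * x) : ℝ) : ℂ) * Complex.I := fun x => by
    rw [fourier_coe_apply, show 2 * (Real.pi : ℂ) * Complex.I * ((-n : ℤ) : ℂ) * (x : ℂ)
        / ((T - 0 : ℝ) : ℂ) = ((-(2 * Real.pi * n / T * x) : ℝ) : ℂ) * Complex.I by
      push_cast; ring, Complex.exp_mul_I, ← Complex.ofReal_cos, ← Complex.ofReal_sin,
      Real.cos_neg, Real.sin_neg]
    push_cast
    simp only [smul_eq_mul]
    ring
  simp_rw [h1]
  have hc' : IntervalIntegrable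
      (fun x => ((f x * Real.cos (2 * Real.pi * n / T * x) : ℝ) : ℂ)) volume 0 T :=
    ⟨hc.1.ofReal, hc.2.ofReal⟩
  have hs' : IntervalIntegrable
      (fun x => ((f x * Real.sin (2 * Real.pi * n / T * x) : ℝ) : ℂ)) volume 0 T :=
    ⟨hs.1.ofReal, hs.2.ofReal⟩
  rw [intervalIntegral.integral_sub hc' (hs'.mul_const Complex.I),
    intervalIntegral.integral_mul_const, intervalIntegral.integral_ofReal,
    intervalIntegral.integral_ofReal, norm_smul, mul_pow]
  congr 1
  · simp
  · rw [← Complex.normSq_eq_norm_sq, Complex.normSq_apply]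
    simp
    ring

theorem memLp_two_ofReal {T : ℝ} (hT : 0 < T) {f : ℝ → ℝ} (hf : IntervalIntegrable f volume 0 T)
    (hf2 : IntervalIntegrable (fun x => f x ^ 2) volume 0 T) :
    MemLp (fun x => (f x : ℂ)) 2 (volume.restrict (Set.Ioc 0 T)) := by
  rw [intervalIntegrable_iff_integrableOn_Ioc_of_le hT.le] at hf hf2
  exact ((memLp_two_iff_integrable_sq hf.aestronglyMeasurable).2 hf2).ofReal

/-- Wirtinger's inequality for periodic functions with mean value zero: by Parseval's identity,
it suffices to compare Fourier coefficients. -/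
theorem IsPrimitive.wirtinger {T : ℝ} (hT : 0 < T) {w γ : ℝ → ℝ} (h : IsPrimitive T w γ)
    (hper : w T = w 0) (hmean : ∫ x in (0 : ℝ)..T, w x = 0) :
    (2 * Real.pi / T) ^ 2 * ∫ x in (0 : ℝ)..T, w x ^ 2 ≤ ∫ x in (0 : ℝ)..T, γ x ^ 2 := by
  have hwc := h.continuousOn
  have hw : IntervalIntegrable w volume 0 T := hwc.intervalIntegrable
  have hw2 : IntervalIntegrable (fun x => w x ^ 2) volume 0 T := (hwc.pow 2).intervalIntegrable
  have hpi := Real.pi_pos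
  have P1 := hasSum_sq_fourierCoeffOn hT (memLp_two_ofReal hT hw hw2)
  have P2 := hasSum_sq_fourierCoeffOn hT (memLp_two_ofReal hT h.integrable h.integrable_sq)
  have hle := hasSum_le (fun n => ?_) (P1.mul_left ((2 * Real.pi / T) ^ 2)) P2
  · simp only [sub_zero, smul_eq_mul, Complex.norm_real, Real.norm_eq_abs, sq_abs] at hle
    rw [mul_left_comm] at hle
    exact le_of_mul_le_mul_left hle (inv_pos.2 hT)
  · rw [norm_sq_fourierCoeffOn hT hw, norm_sq_fourierCoeffOn hT h.integrable]
    set θ := 2 * Real.pi * n / T with hθ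
    have hcosT : Real.cos (θ * T) = 1 := by
      rw [hθ, div_mul_cancel₀ _ hT.ne', mul_comm]
      exact Real.cos_int_mul_two_pi n
    have hsinT : Real.sin (θ * T) = 0 := by
      rw [hθ, div_mul_cancel₀ _ hT.ne', mul_comm (2 * Real.pi), ← mul_assoc, ← Int.cast_two,
        ← Int.cast_mul]
      exact Real.sin_int_mul_pi _
    have hlin : ∀ x, HasDerivAt (fun x => θ * x) θ x := fun x => by
      simpa using (hasDerivAt_id x).const_mul θ
    have h1 := h.integral_mul_deriv (φ := fun x => Real.cos (θ * x))
      (φ' := fun x => -Real.sin (θ * x) * θ) (fun x => (hlin x).cos) (by fun_prop)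
    have h2 := h.integral_mul_deriv (φ := fun x => Real.sin (θ * x))
      (φ' := fun x => Real.cos (θ * x) * θ) (fun x => (hlin x).sin) (by fun_prop)
    simp only [hcosT, hsinT, hper, mul_zero, Real.cos_zero, Real.sin_zero, mul_one, sub_self,
      zero_sub, ← mul_assoc, mul_neg, neg_mul, intervalIntegral.integral_neg,
      intervalIntegral.integral_mul_const, neg_inj] at h1 h2
    rw [← h1, ← neg_eq_iff_eq_neg.2 h2]
    rcases eq_or_ne n 0 with rfl | hn
    · have hθ0 : θ = 0 := by simp [hθ]
      simp [hθ0, hmean]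
    · have hn1 : (1 : ℝ) ≤ (n : ℝ) ^ 2 := by
        have : (1 : ℤ) ≤ n ^ 2 := by
          have := Int.one_le_abs hn
          rw [← sq_abs]
          nlinarith
        exact_mod_cast this
      have hθ2 : (2 * Real.pi / T) ^ 2 ≤ θ ^ 2 := by
        rw [hθ, show 2 * Real.pi * n / T = 2 * Real.pi / T * n by ring, mul_pow]
        exact le_mul_of_one_le_right (sq_nonneg _) hn1
      set A := ∫ x in (0 : ℝ)..T, w x * Real.cos (θ * x)
      set B := ∫ x in (0 : ℝ)..T, w x * Real.sin (θ * x)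
      have : 0 ≤ (1 / T) ^ 2 * (A ^ 2 + B ^ 2) := by positivity
      calc _ ≤ θ ^ 2 * ((1 / T) ^ 2 * (A ^ 2 + B ^ 2)) := by gcongr
        _ = _ := by ring

/-! ### A closed walk through every edge in both directions -/

/-- The start of an edge with an orientation. -/
def dartStart (G : MetricGraph V E) (d : E × Bool) : V := if d.2 then G.src d.1 else G.tgt d.1

/-- The end of an edge with an orientation. -/
def dartEnd (G : MetricGraph V E) (d : E × Bool) : V := if d.2 then G.tgt d.1 else G.src d.1

/-- `G.IsWalk v w l`: the oriented edges in the list `l` form a walk from `v` to `w`. -/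
inductive IsWalk (G : MetricGraph V E) : V → V → List (E × Bool) → Prop
  | nil (v : V) : IsWalk G v v []
  | cons (d : E × Bool) {w : V} {l : List (E × Bool)} (h : IsWalk G (G.dartEnd d) w l) :
      IsWalk G (G.dartStart d) w (d :: l)

theorem IsWalk.append {u v w : V} {l l' : List (E × Bool)} (h : G.IsWalk u v l)
    (h' : G.IsWalk v w l') : G.IsWalk u w (l ++ l') := by
  induction h with
  | nil => exact h'
  | cons d h ih => exact .cons d (ih h')

/-- A walk can be split at each vertex it visits. -/
theorem IsWalk.split {u w : V} {l : List (E × Bool)} (h : G.IsWalk u w l) {v : V}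
    (hv : v = w ∨ ∃ d ∈ l, G.dartStart d = v) :
    ∃ l₁ l₂, l = l₁ ++ l₂ ∧ G.IsWalk u v l₁ ∧ G.IsWalk v w l₂ := by
  induction h with
  | nil x =>
    obtain rfl : v = x := by simpa using hv
    exact ⟨[], [], rfl, .nil _, .nil _⟩
  | @cons d w l h ih =>
    by_cases hd : G.dartStart d = v
    · subst hd
      exact ⟨[], d :: l, rfl, .nil _, .cons d h⟩
    · obtain ⟨l₁, l₂, rfl, h1, h2⟩ := ih (by simpa [hd] using hv)
      exact ⟨d :: l₁, l₂, rfl, .cons d h1, h2⟩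

/-- There is a closed walk using every edge exactly once in each direction: when a new edge is
added to the graph, the walk makes an excursion along this edge and back. -/
theorem Connected.exists_closed_walk [Fintype V] [Fintype E] (hG : G.Connected) :
    ∃ v l, G.IsWalk v v l ∧
      ∀ F : E × Bool → ℝ, (l.map F).sum = ∑ e, (F (e, true) + F (e, false)) := by
  classical
  obtain ⟨v₀⟩ := hG.1
  have := hG.edge_induction (fun S A => ∃ l, G.IsWalk v₀ v₀ l ∧
      (∀ v ∈ A, v = v₀ ∨ ∃ d ∈ l, G.dartStart d = v) ∧
      ∀ F : E × Bool → ℝ, (l.map F).sum = ∑ e ∈ S, (F (e, true) + F (e, false))) v₀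
    ⟨[], .nil _, by simp, by simp⟩ ?_
  · obtain ⟨l, h1, -, h2⟩ := this
    exact ⟨v₀, l, h1, h2⟩
  rintro S A e v w he hv hvw ⟨l, hl, hA, hF⟩
  obtain ⟨b, hb1, hb2⟩ : ∃ b : Bool, G.dartStart (e, b) = v ∧ G.dartEnd (e, b) = w := by
    rcases hvw with h | h
    · exact ⟨true, by simpa [dartStart, dartEnd] using h⟩
    · exact ⟨false, by simpa [dartStart, dartEnd] using h⟩
  have hb3 : G.dartStart (e, !b) = w := by rw [← hb2]; cases b <;> rfl
  have hb4 : G.dartEnd (e, !b) = v := by rw [← hb1]; cases b <;> rfl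
  obtain ⟨l₁, l₂, rfl, h1, h2⟩ := hl.split (hA v hv)
  have h3 : G.IsWalk v v [(e, b), (e, !b)] := by
    have h4 : G.IsWalk (G.dartStart (e, !b)) v [(e, !b)] := .cons _ (by rw [hb4]; exact .nil v)
    rw [hb3, ← hb2] at h4
    have h5 := IsWalk.cons _ h4
    rwa [hb1] at h5
  refine ⟨l₁ ++ ([(e, b), (e, !b)] ++ l₂), h1.append (h3.append h2), fun x hx => ?_, fun F => ?_⟩
  · rcases Finset.mem_insert.1 hx with rfl | hx
    · exact .inr ⟨(e, !b), by simp, hb3⟩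
    · refine (hA x hx).imp_right ?_
      rintro ⟨d, hd, hdx⟩
      refine ⟨d, ?_, hdx⟩
      rcases List.mem_append.1 hd with h | h <;> simp [h]
  · rw [Finset.sum_insert he, ← hF F]
    cases b <;> simp <;> ring

/-! ### Unrolling a function along a walk -/

theorem IsPrimitive.reverse {T : ℝ} {w γ : ℝ → ℝ} (h : IsPrimitive T w γ) :
    IsPrimitive T (fun x => w (T - x)) (fun x => -γ (T - x)) where
  nonneg := h.nonneg
  integrable := by
    have := (h.integrable.comp_sub_left T).symm.neg
    rw [sub_zero, sub_self] at this
    exact this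
  integrable_sq := by simpa using (h.integrable_sq.comp_sub_left T).symm
  eq_integral x hx := by
    have hx' : T - x ∈ Set.Icc 0 T := ⟨sub_nonneg.2 hx.2, sub_le_self _ hx.1⟩
    have hsub : IntervalIntegrable γ volume 0 (T - x) := h.integrable.mono_set (by
      rw [Set.uIcc_of_le hx'.1, Set.uIcc_of_le h.nonneg]; exact Set.Icc_subset_Icc_right hx'.2)
    rw [sub_zero, h.eq_integral _ hx', h.eq_integral T ⟨h.nonneg, le_rfl⟩,
      intervalIntegral.integral_neg, intervalIntegral.integral_comp_sub_left γ T, sub_zero,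
      ← intervalIntegral.integral_interval_sub_left h.integrable hsub]
    ring

/-- Concatenation of two functions along adjacent intervals. -/
noncomputable def concat (T : ℝ) (f g : ℝ → ℝ) (x : ℝ) : ℝ := if x ≤ T then f x else g (x - T)

section concat

variable {T T' : ℝ} {f g : ℝ → ℝ}

theorem concat_eqOn_left (hT : 0 ≤ T) : Set.EqOn f (concat T f g) (Set.uIoc 0 T) := by
  intro x hx
  rw [Set.uIoc_of_le hT] at hx
  simp [concat, hx.2]

theorem concat_eqOn_right (hT' : 0 ≤ T') :
    Set.EqOn (fun x => g (x - T)) (concat T f g) (Set.uIoc T (T + T')) := by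
  intro x hx
  rw [Set.uIoc_of_le (by linarith)] at hx
  simp [concat, hx.1]

theorem intervalIntegrable_concat_left (hT : 0 ≤ T) (hf : IntervalIntegrable f volume 0 T) :
    IntervalIntegrable (concat T f g) volume 0 T :=
  hf.congr (concat_eqOn_left hT)

theorem intervalIntegrable_concat_right (hT' : 0 ≤ T') (hg : IntervalIntegrable g volume 0 T') :
    IntervalIntegrable (concat T f g) volume T (T + T') := by
  have h1 := hg.comp_sub_right T
  rw [zero_add, add_comm T'] at h1
  exact h1.congr (concat_eqOn_right hT')

theorem integral_concat_left (hT : 0 ≤ T) :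
    ∫ x in (0 : ℝ)..T, concat T f g x = ∫ x in (0 : ℝ)..T, f x :=
  intervalIntegral.integral_congr_ae (Filter.Eventually.of_forall fun _ hx =>
    (concat_eqOn_left hT hx).symm)

theorem integral_concat_right (hT' : 0 ≤ T') :
    ∫ x in T..(T + T'), concat T f g x = ∫ x in (0 : ℝ)..T', g x := by
  rw [intervalIntegral.integral_congr_ae (g := fun x => g (x - T))
    (Filter.Eventually.of_forall fun _ hx => (concat_eqOn_right hT' hx).symm),
    intervalIntegral.integral_comp_sub_right g T]
  simp

theorem integral_concat (hT : 0 ≤ T) (hT' : 0 ≤ T') (hf : IntervalIntegrable f volume 0 T)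
    (hg : IntervalIntegrable g volume 0 T') :
    ∫ x in (0 : ℝ)..(T + T'), concat T f g x
      = (∫ x in (0 : ℝ)..T, f x) + ∫ x in (0 : ℝ)..T', g x := by
  rw [← intervalIntegral.integral_add_adjacent_intervals (intervalIntegrable_concat_left hT hf)
    (intervalIntegrable_concat_right hT' hg), integral_concat_left hT, integral_concat_right hT']

theorem concat_sq :
    (fun x => concat T f g x ^ 2) = concat T (fun x => f x ^ 2) fun x => g x ^ 2 := by
  funext x
  unfold concat
  split_ifs <;> rfl

end concat

theorem IsPrimitive.concat {T T' : ℝ} {w γ w' γ' : ℝ → ℝ} (h : IsPrimitive T w γ)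
    (h' : IsPrimitive T' w' γ') (hw : w T = w' 0) :
    IsPrimitive (T + T') (concat T w w') (concat T γ γ') where
  nonneg := add_nonneg h.nonneg h'.nonneg
  integrable := (intervalIntegrable_concat_left h.nonneg h.integrable).trans
    (intervalIntegrable_concat_right h'.nonneg h'.integrable)
  integrable_sq := by
    rw [concat_sq]
    exact (intervalIntegrable_concat_left h.nonneg h.integrable_sq).trans
      (intervalIntegrable_concat_right h'.nonneg h'.integrable_sq)
  eq_integral x hx := by
    have h0 : MetricGraph.concat T w w' 0 = w 0 := by simp [MetricGraph.concat, h.nonneg]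
    rw [h0]
    rcases le_or_gt x T with hxT | hxT
    · rw [MetricGraph.concat, if_pos hxT, h.eq_integral x ⟨hx.1, hxT⟩]
      congr 1
      refine intervalIntegral.integral_congr_ae (Filter.Eventually.of_forall fun t ht => ?_)
      rw [Set.uIoc_of_le hx.1] at ht
      simp [MetricGraph.concat, ht.2.trans hxT]
    · have hx' : x - T ∈ Set.Icc 0 T' := ⟨by linarith, by linarith [hx.2]⟩
      have hsub : IntervalIntegrable γ' volume 0 (x - T) := h'.integrable.mono_set (by
        rw [Set.uIcc_of_le hx'.1, Set.uIcc_of_le h'.nonneg]; exact Set.Icc_subset_Icc_right hx'.2)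
      rw [MetricGraph.concat, if_neg hxT.not_ge, h'.eq_integral _ hx', ← hw,
        h.eq_integral T ⟨h.nonneg, le_rfl⟩, add_assoc,
        ← integral_concat h.nonneg hx'.1 h.integrable hsub, add_sub_cancel]

/-- A function in `H¹` is pulled back along a walk to a function on an interval. -/
theorem IsH1.unroll {u : G.Space → ℝ} {g : E → ℝ → ℝ} (h : G.IsH1 u g) {a b : V}
    {l : List (E × Bool)} (hl : G.IsWalk a b l) :
    ∃ w γ, IsPrimitive (l.map fun d => G.len d.1).sum w γ ∧ w 0 = u (.vertex a) ∧
      w (l.map fun d => G.len d.1).sum = u (.vertex b) ∧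
      ∫ x in (0 : ℝ)..(l.map fun d => G.len d.1).sum, w x
        = (l.map fun d => ∫ x in (0 : ℝ)..(G.len d.1), u (G.pt d.1 x)).sum ∧
      ∫ x in (0 : ℝ)..(l.map fun d => G.len d.1).sum, w x ^ 2
        = (l.map fun d => ∫ x in (0 : ℝ)..(G.len d.1), u (G.pt d.1 x) ^ 2).sum ∧
      ∫ x in (0 : ℝ)..(l.map fun d => G.len d.1).sum, γ x ^ 2
        = (l.map fun d => ∫ x in (0 : ℝ)..(G.len d.1), g d.1 x ^ 2).sum := by
  induction hl with
  | nil v => exact ⟨fun _ => u (.vertex v), fun _ => 0, ⟨by simp, by simp, by simp, by simp⟩,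
      by simp⟩
  | @cons d b l hl ih =>
    obtain ⟨w', γ', hP', h0', h1', hI', hS', hD'⟩ := ih
    obtain ⟨w, γ, hP, h0, h1, hI, hS, hD⟩ : ∃ w γ, IsPrimitive (G.len d.1) w γ ∧
        w 0 = u (.vertex (G.dartStart d)) ∧ w (G.len d.1) = u (.vertex (G.dartEnd d)) ∧
        ∫ x in (0 : ℝ)..(G.len d.1), w x = ∫ x in (0 : ℝ)..(G.len d.1), u (G.pt d.1 x) ∧
        ∫ x in (0 : ℝ)..(G.len d.1), w x ^ 2 = ∫ x in (0 : ℝ)..(G.len d.1), u (G.pt d.1 x) ^ 2 ∧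
        ∫ x in (0 : ℝ)..(G.len d.1), γ x ^ 2 = ∫ x in (0 : ℝ)..(G.len d.1), g d.1 x ^ 2 := by
      obtain ⟨e, b⟩ := d
      have hP := h.isPrimitive e
      cases b
      · refine ⟨_, _, hP.reverse, by simp [pt_len, dartStart], by simp [pt_zero, dartEnd],
          ?_, ?_, ?_⟩
        · simpa using intervalIntegral.integral_comp_sub_left (a := 0) (b := G.len e)
            (fun x => u (G.pt e x)) (G.len e)
        · simpa using intervalIntegral.integral_comp_sub_left (a := 0) (b := G.len e)
            (fun x => u (G.pt e x) ^ 2) (G.len e)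
        · simpa using intervalIntegral.integral_comp_sub_left (a := 0) (b := G.len e)
            (fun x => g e x ^ 2) (G.len e)
      · exact ⟨_, _, hP, by simp [pt_zero, dartStart], by simp [pt_len, dartEnd], rfl, rfl, rfl⟩
    have hw := hP.continuousOn
    have hw' := hP'.continuousOn
    have hw2 : IntervalIntegrable (fun x => w x ^ 2) volume 0 (G.len d.1) :=
      (hw.pow 2).intervalIntegrable
    have hw2' : IntervalIntegrable (fun x => w' x ^ 2) volume 0
        (l.map fun d => G.len d.1).sum := (hw'.pow 2).intervalIntegrable
    refine ⟨concat (G.len d.1) w w', concat (G.len d.1) γ γ', ?_, ?_, ?_, ?_, ?_, ?_⟩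
    · exact hP.concat hP' (h1.trans h0'.symm)
    · simp [concat, G.len_nonneg, h0]
    · rw [List.map_cons, List.sum_cons, ← h1']
      rcases hP'.nonneg.eq_or_lt with h2 | h2
      · rw [← h2, add_zero, concat, if_pos le_rfl, h1, h0']
      · simp [concat, h2]
    · rw [List.map_cons, List.sum_cons, List.map_cons, List.sum_cons, ← hI, ← hI',
        integral_concat hP.nonneg hP'.nonneg hw.intervalIntegrable hw'.intervalIntegrable]
    · rw [List.map_cons, List.sum_cons, List.map_cons, List.sum_cons, ← hS, ← hS', concat_sq,
        integral_concat hP.nonneg hP'.nonneg hw2 hw2']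
    · rw [List.map_cons, List.sum_cons, List.map_cons, List.sum_cons, ← hD, ← hD', concat_sq,
        integral_concat hP.nonneg hP'.nonneg hP.integrable_sq hP'.integrable_sq]

/-- The lower bound for the spectral gap: a function on the graph becomes a function on a circle of
twice the length along the closed walk that uses every edge twice. -/
theorem le_spectralGap [Fintype V] [Fintype E] [Nonempty E] (hG : G.Connected) :
    (Real.pi / G.totalLength) ^ 2 ≤ G.spectralGap := by
  have hL := G.totalLength_pos
  refine le_csInf ?_ ?_
  · -- a nonzero function with mean value zero
    let f : E → ℝ → ℝ := fun e x => Real.sin ((2 : ℤ) * Real.pi / G.len e * x)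
    let f' : E → ℝ → ℝ := fun e x =>
      Real.cos ((2 : ℤ) * Real.pi / G.len e * x) * ((2 : ℤ) * Real.pi / G.len e)
    have hd : ∀ e x, HasDerivAt (f e) (f' e x) x := fun e x => by
      simpa [f, f'] using ((hasDerivAt_id x).const_mul ((2 : ℤ) * Real.pi / G.len e)).sin
    have h0 : ∀ e, f e 0 = (fun _ : V => 0) (G.src e) := fun e => by simp [f]
    have h1 : ∀ e, f e (G.len e) = (fun _ : V => 0) (G.tgt e) := fun e => by
      simp [f, (G.len_pos e).ne']
    refine ⟨_, G.glue (fun _ => 0) f, f', isH1_glue hd (fun e => by fun_prop) h0 h1, ?_, ?_, rfl⟩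
    · refine (integral_glue h0 h1 fun t => t).trans (Finset.sum_eq_zero fun e _ => ?_)
      have hl := (G.len_pos e).ne'
      have hpi := Real.pi_ne_zero
      simp only [f]
      rw [intervalIntegral.integral_comp_mul_left (fun x => Real.sin x) (by positivity),
        integral_sin, div_mul_cancel₀ _ hl]
      simp
    · rw [integral_glue h0 h1 fun t => t ^ 2, Finset.sum_congr rfl fun e _ =>
        show ∫ x in (0 : ℝ)..(G.len e), f e x ^ 2 = G.len e / 2 by
          simp only [f, sq]
          rw [integral_sin_mul_sin (G.len_pos e)]
          norm_num, ← Finset.sum_div]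
      exact (half_pos hL).ne'
  rintro q ⟨u, g, hu, hmean, hne, rfl⟩
  have hpos : 0 < G.integral (fun p => u p ^ 2) := lt_of_le_of_ne
    (Finset.sum_nonneg fun e _ => integral_sq_nonneg (fun x => u (G.pt e x)) e) (Ne.symm hne)
  obtain ⟨v, l, hl, hF⟩ := hG.exists_closed_walk
  obtain ⟨w, γ, hP, h0, h1, hI, hS, hD⟩ := hu.unroll hl
  simp only [hF (fun d => G.len d.1), hF (fun d => ∫ x in (0 : ℝ)..(G.len d.1), u (G.pt d.1 x)),
    hF (fun d => ∫ x in (0 : ℝ)..(G.len d.1), u (G.pt d.1 x) ^ 2),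
    hF (fun d => ∫ x in (0 : ℝ)..(G.len d.1), g d.1 x ^ 2), ← two_mul, ← Finset.mul_sum]
    at hP h1 hI hS hD
  change IsPrimitive (2 * G.totalLength) w γ at hP
  have h2 := hP.wirtinger (by positivity) (h1.trans h0.symm) (hI.trans (by
    change 2 * G.integral u = 0
    rw [hmean, mul_zero]))
  change ∫ x in (0 : ℝ)..(2 * G.totalLength), w x ^ 2 = 2 * G.integral (fun p => u p ^ 2) at hS
  change ∫ x in (0 : ℝ)..(2 * G.totalLength), γ x ^ 2 = _ at hD
  rw [hS, hD, show 2 * Real.pi / (2 * G.totalLength) = Real.pi / G.totalLength by field_simp,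
    mul_left_comm] at h2
  rw [le_div_iff₀ hpos]
  linarith

/-! ### The bounds for the product -/

theorem spectralGap_mul_meanDist_sq_le_card_edges [Fintype V] [Fintype E] [Nonempty E]
    (hG : G.Connected) (hloop : ¬ G.IsLoop) :
    G.spectralGap * G.meanDist ^ 2 ≤ Real.pi ^ 2 * (Fintype.card E : ℝ) ^ 2 / 9 := by
  have hL := G.totalLength_pos
  have hρ := (meanDist_pos hG).le
  calc _ ≤ (Real.pi * Fintype.card E / G.totalLength) ^ 2 * (G.totalLength / 3) ^ 2 := by
        gcongr
        · exact spectralGap_le_card_edges hG hloop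
        · exact meanDist_le_third hG
    _ = _ := by field_simp; ring

theorem le_spectralGap_mul_meanDist_sq [Fintype V] [Fintype E] [Nonempty E] (hG : G.Connected) :
    Real.pi ^ 2 * (2 * (Fintype.card E : ℝ) - 1) ^ 2 / (16 * (Fintype.card E : ℝ) ^ 4)
      ≤ G.spectralGap * G.meanDist ^ 2 := by
  have hL := G.totalLength_pos
  have h1 : (1 : ℝ) ≤ Fintype.card E := by exact_mod_cast Fintype.card_pos
  have h2 : 0 ≤ 2 * (Fintype.card E : ℝ) - 1 := by linarith
  have hμ := G.spectralGap_nonneg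
  calc _ = (Real.pi / G.totalLength) ^ 2 *
        (G.totalLength * (2 * (Fintype.card E : ℝ) - 1) / (4 * (Fintype.card E : ℝ) ^ 2)) ^ 2 := by
        field_simp; ring
    _ ≤ _ := by
        gcongr
        · exact le_spectralGap hG
        · exact le_meanDist hG

end MetricGraph

theorem mainTheorem4 {V E : Type*} [Fintype V] [Fintype E] [Nonempty E]
    (G : MetricGraph V E) (hG : G.Connected) :
    Real.pi ^ 2 * (2 * (Fintype.card E : ℝ) - 1) ^ 2 / (16 * (Fintype.card E : ℝ) ^ 4)
        ≤ G.spectralGap * G.meanDist ^ 2 ∧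
    G.spectralGap * G.meanDist ^ 2 ≤ Real.pi ^ 2 * (1 + (G.betti : ℝ)) ^ 2 ∧
    (¬ G.IsLoop →
      G.spectralGap * G.meanDist ^ 2
        ≤ min (Real.pi ^ 2 * (Fintype.card E : ℝ) ^ 2 / 9)
            (Real.pi ^ 2 * (1 + (G.betti : ℝ)) ^ 2)) := by
  exact ⟨MetricGraph.le_spectralGap_mul_meanDist_sq hG,
    MetricGraph.spectralGap_mul_meanDist_sq_le_betti hG, fun hloop =>
    le_min (MetricGraph.spectralGap_mul_meanDist_sq_le_card_edges hG hloop)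
      (MetricGraph.spectralGap_mul_meanDist_sq_le_betti hG)⟩
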